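/- **Setting.** Let $\mathcal X\subseteq\mathbb R^d$ be measurable, let $q$ be a Lebesgue probability density on $\mathcal X$ (the known covariate density), and let $(W,Y)\in\mathbb R^m\times\mathbb R$ have conditional law $\kappa(x,\cdot)$ given $X=x$, where $\kappa$ is a Markov kernel. Let $f$ be a measurable predictor and $F=f(X,W)$. The target is $\theta=\mathbb E[Y]$, where $X\sim q$. A (non-adaptive) design is a Lebesgue probability density $p$ on $\mathcal X$ together with a measurable $\pi\le 1$. The units $(X_t,W_t,Y_t,\Delta_t)$, $t=1,2,\dots$, are i.i.d. with $X_t\sim p$, $(W_t,Y_t)\mid X_t\sim\kappa(X_t,\cdot)$, and $\Delta_t\in\{0,1\}$ Bernoulli with success probability $\pi(X_t)$ given $(X_t,W_t,Y_t)$; one observes $Z_t=(X_t,F_t,\Delta_t,\Delta_tY_t)$ with $F_t=f(X_t,W_t)$. Write $P$ for the law of $(X,W,Y)$ under this sampling, $\mu(X)=\mathbb E[Y\mid X]$, $\tau(X,F)=\mathbb E[Y\mid X,F]$, and $$V(p,\pi)=\mathbb E_{X\sim p}\left[\frac{q^2(X)}{p^2(X)}\left(\frac1{\pi(X)}\mathbb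 E[\operatorname{Var}(Y\mid X,F)\mid X]+\operatorname{Var}(\mathbb E[Y\mid X,F]\mid X)\right)\right],$$ the semiparametric efficiency bound for $\theta$. **Estimator.** Fix the number of folds $K\ge1$. The fold labels $S_t\in\{1,\dots,K\}$ are i.i.d. uniform and independent of the units, and $N_k=\#\{t\le T:S_t=k\}$. For each $T$ and $k$, $\hat\mu^{-k}$ and $\hat\tau^{-k}$ are estimates of $\mu$ and $\tau$ that are jointly measurable functions of their arguments and of the observations $Z_t$, $t\le T$, with $S_t\ne k$; they may also depend on the fold labels and on a random seed independent of all units and labels. Put $$\hat\Psi(Z_t;\hat\mu,\hat\tau)=\frac{q(X_t)}{\pi(X_t)p(X_t)}\Big[\Delta_t\big(Y_t-\hat\tau(X_t,F_t)\big)-\pi(X_t)\big(\hat\mu(X_t)-\hat\tau(X_t,F_t)\big)\Big],$$ $$\hat\theta_T=\sum_{k=1}^K\frac{N_k}{T}\Big[\mathbb E_{X\sim q}[\hat\mu^{-k}(X)]+\frac1{N_k}\sum_{t\le T:\,S_t=k}\hat\Psi(Z_t;\hat\mu^{-k},\hat\tau^{-k})\Big],$$ where an empty fold contributes $0$. **Theorem.**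 Assume that there are constants $p_{\min}>0$, $\pi_{\min}>0$ and $C$ such that, almost everywhere on $\mathcal X$, $p\ge p_{\min}$ and $\pi\ge\pi_{\min}$, and such that $|Y|$, $|\mu(X)|$, $|\tau(X,F)|$ and, for all $T$ and $k$, almost surely $|\hat\mu^{-k}(X)|$ and $|\hat\tau^{-k}(X,F)|$ are at most $C$ for $P$-almost every $(X,W,Y)$. Assume moreover that $\mathbb E_{X\sim p}[q^2(X)/p^2(X)]<\infty$ and that the estimates are consistent: for every $k$, $$\int\big(\hat\mu^{-k}(X)-\mu(X)\big)^2\,dP\to0\quad\text{and}\quad\int\big(\hat\tau^{-k}(X,F)-\tau(X,F)\big)^2\,dP\to0\quad\text{in probability as }T\to\infty.$$ Then $0\le V(p,\pi)<\infty$ and the estimator $\hat\theta_T$ is efficient, i.e. $$\sqrt T\,(\hat\theta_T-\theta)\xrightarrow{d}\mathcal N(0,V(p,\pi))\qquad(T\to\infty),$$ where $\mathcal N(0,0)$ is the point mass at $0$. -/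

import Mathlib

open MeasureTheory ProbabilityTheory Filter

noncomputable section

namespace PGAE

/-- Covariates and side information live in Euclidean spaces `ℝⁿ`. -/
abbrev Vec (n : ℕ) : Type := EuclideanSpace ℝ (Fin n)

/-- A complete record `(X, W, Y)` of one individual: covariate, side information, outcome. -/
abbrev Record (d m : ℕ) : Type := Vec d × Vec m × ℝ

/-- What the experimenter sees of one individual: `(X, F, Δ, Δ Y)`. -/
abbrev Obs (d : ℕ) : Type := Vec d × ℝ × Bool × ℝ

/-- `Δ` as a real number: `1` if the experiment was conducted, `0` otherwise. -/
def ind (δ : Bool) : ℝ := if δ then 1 else 0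

/-- `g` is a (Lebesgue) probability density on `𝒳 ⊆ ℝᵈ`. -/
structure IsDensityOn {d : ℕ} (𝒳 : Set (Vec d)) (g : Vec d → ℝ) : Prop where
  measurable : Measurable g
  nonneg : ∀ᵐ x ∂(volume.restrict 𝒳), 0 ≤ g x
  lintegral_eq_one : ∫⁻ x in 𝒳, ENNReal.ofReal (g x) = 1

/-- The distribution `g(x) dx` on `𝒳`. -/
def densityMeasure {d : ℕ} (𝒳 : Set (Vec d)) (g : Vec d → ℝ) : Measure (Vec d) :=
  (volume.restrict 𝒳).withDensity (fun x => ENNReal.ofReal (g x))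

/-- The law of `(X, W, Y)` when `X` has density `g` on `𝒳` and `(W, Y)` given `X = x` has law
`κ x`. With `g = q` this is the population, with `g = p` an individual sampled from `p`. -/
def recordLaw {d m : ℕ} (𝒳 : Set (Vec d)) (g : Vec d → ℝ) (κ : Kernel (Vec d) (Vec m × ℝ)) :
    Measure (Record d m) :=
  densityMeasure 𝒳 g ⊗ₘ κ

/-- The law of `((X, W, Y), Δ)` under the design `(p, π)`: `X ∼ p`, `(W, Y) ∣ X ∼ κ X` and, given
`(X, W, Y)`, `Δ` is Bernoulli with success probability `π(X)`. -/
def unitLaw {d m : ℕ} (𝒳 : Set (Vec d)) (p π : Vec d → ℝ) (κ : Kernel (Vec d) (Vec m × ℝ)) :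
    Measure (Record d m × Bool) :=
  ((recordLaw 𝒳 p κ).prod Measure.count).withDensity
    (fun u => ENNReal.ofReal (if u.2 then π u.1.1 else 1 - π u.1.1))

/-- The target `θ = E[Y]`, the mean outcome in the population. -/
def theta {d m : ℕ} (𝒳 : Set (Vec d)) (q : Vec d → ℝ) (κ : Kernel (Vec d) (Vec m × ℝ)) : ℝ :=
  ∫ z, z.2.2 ∂(recordLaw 𝒳 q κ)

/-- The prediction `F = f(X, W)`. -/
def pred {d m : ℕ} (f : Vec d × Vec m → ℝ) (z : Record d m) : ℝ := f (z.1, z.2.1)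

/-- The σ-algebra `σ(X)`. -/
abbrev sigmaX (d m : ℕ) : MeasurableSpace (Record d m) :=
  MeasurableSpace.comap (fun z => z.1) inferInstance

/-- The σ-algebra `σ(X, F)`. -/
abbrev sigmaXF {d m : ℕ} (f : Vec d × Vec m → ℝ) : MeasurableSpace (Record d m) :=
  MeasurableSpace.comap (fun z => (z.1, pred f z)) inferInstance

/-- The outcome `Y` as a random variable on records. -/
def outcome {d m : ℕ} (z : Record d m) : ℝ := z.2.2

/-- `μ(X) = E[Y ∣ X]`, as a random variable on records. -/
def mu {d m : ℕ} (P : Measure (Record d m)) : Record d m → ℝ :=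
  condExp (sigmaX d m) P outcome

/-- `τ(X, F) = E[Y ∣ X, F]`, as a random variable on records. -/
def tau {d m : ℕ} (f : Vec d × Vec m → ℝ) (P : Measure (Record d m)) : Record d m → ℝ :=
  condExp (sigmaXF f) P outcome

/-- The integrand
`(q(X)/p(X))² (π(X)⁻¹ E[Var(Y ∣ X, F) ∣ X] + Var(E[Y ∣ X, F] ∣ X))` of the efficiency bound. -/
def boundIntegrand {d m : ℕ} (𝒳 : Set (Vec d)) (q p π : Vec d → ℝ)
    (κ : Kernel (Vec d) (Vec m × ℝ)) (f : Vec d × Vec m → ℝ) (z : Record d m) : ℝ :=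
  q z.1 ^ 2 / p z.1 ^ 2 *
    (1 / π z.1 *
        condExp (sigmaX d m) (recordLaw 𝒳 p κ)
          (condVar (sigmaXF f) outcome (recordLaw 𝒳 p κ)) z +
      condVar (sigmaX d m) (tau f (recordLaw 𝒳 p κ)) (recordLaw 𝒳 p κ) z)

/-- The efficiency bound `V(p, π)`. -/
def effBound {d m : ℕ} (𝒳 : Set (Vec d)) (q p π : Vec d → ℝ)
    (κ : Kernel (Vec d) (Vec m × ℝ)) (f : Vec d × Vec m → ℝ) : ℝ :=
  ∫ z, boundIntegrand 𝒳 q p π κ f z ∂(recordLaw 𝒳 p κ)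

/-- The observation `(X, F, Δ, Δ Y)` obtained from a record and the indicator `Δ`. -/
def observe {d m : ℕ} (f : Vec d × Vec m → ℝ) (u : Record d m × Bool) : Obs d :=
  (u.1.1, pred f u.1, u.2, ind u.2 * outcome u.1)

/-- The estimated influence function
`q(X)/(π(X)p(X)) · [Δ (Y - τ̂(X,F)) - π(X) (μ̂(X) - τ̂(X,F))]`; it uses `Y` only through `Δ Y`. -/
def inflHat {d : ℕ} (q p π : Vec d → ℝ) (mhat : Vec d → ℝ) (that : Vec d → ℝ → ℝ)
    (o : Obs d) : ℝ :=
  q o.1 / (π o.1 * p o.1) *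
    ((o.2.2.2 - ind o.2.2.1 * that o.1 o.2.1) - π o.1 * (mhat o.1 - that o.1 o.2.1))

/-- A pair of learning procedures for `μ` and `τ` to be used with `K`-fold cross-fitting. For
sample size `T`, fold `k` and fold assignment `s`, they return an estimate computed from the
observations outside fold `k` and, possibly, from a random seed in `𝒰`. -/
structure CrossFitLearner (d K : ℕ) (𝒰 : Type*) [MeasurableSpace 𝒰] where
  muHat : (T : ℕ) → (k : Fin K) → (s : Fin T → Fin K) → ({t : Fin T // s t ≠ k} → Obs d) →
    𝒰 → Vec d → ℝ
  tauHat : (T : ℕ) → (k : Fin K) → (s : Fin T → Fin K) → ({t : Fin T // s t ≠ k} → Obs d) →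
    𝒰 → Vec d → ℝ → ℝ
  measurable_muHat : ∀ T k s, Measurable
    (fun a : ({t : Fin T // s t ≠ k} → Obs d) × 𝒰 × Vec d => muHat T k s a.1 a.2.1 a.2.2)
  measurable_tauHat : ∀ T k s, Measurable
    (fun a : ({t : Fin T // s t ≠ k} → Obs d) × 𝒰 × Vec d × ℝ =>
      tauHat T k s a.1 a.2.1 a.2.2.1 a.2.2.2)

section Estimator

variable {d K : ℕ} {𝒰 Ω : Type*} [MeasurableSpace 𝒰]

/-- `μ̂^{-k}` for sample size `T`, given all observations `Z`, all fold labels `S` and the seed. -/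
def CrossFitLearner.muHatExcl (A : CrossFitLearner d K 𝒰) (Z : ℕ → Ω → Obs d)
    (S : ℕ → Ω → Fin K) (seed : Ω → 𝒰) (T : ℕ) (k : Fin K) (ω : Ω) : Vec d → ℝ :=
  A.muHat T k (fun t => S t ω) (fun t => Z t.1 ω) (seed ω)

/-- `τ̂^{-k}` for sample size `T`, given all observations `Z`, all fold labels `S` and the seed. -/
def CrossFitLearner.tauHatExcl (A : CrossFitLearner d K 𝒰) (Z : ℕ → Ω → Obs d)
    (S : ℕ → Ω → Fin K) (seed : Ω → 𝒰) (T : ℕ) (k : Fin K) (ω : Ω) : Vec d → ℝ → ℝ :=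
  A.tauHat T k (fun t => S t ω) (fun t => Z t.1 ω) (seed ω)

/-- The indices `t < T` of the sample that belong to fold `k`. -/
def fold (S : ℕ → Ω → Fin K) (T : ℕ) (k : Fin K) (ω : Ω) : Finset ℕ :=
  (Finset.range T).filter (fun t => S t ω = k)

/-- The cross-fitted one-step estimator
`θ̂_T = ∑ₖ (N_k/T) [E_{X∼q} μ̂^{-k}(X) + (1/N_k) ∑_{t in fold k} Ψ̂(Z_t; μ̂^{-k}, τ̂^{-k})]`.
An empty fold contributes `0`. -/
def thetaHat (𝒳 : Set (Vec d)) (q p π : Vec d → ℝ) (A : CrossFitLearner d K 𝒰)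
    (Z : ℕ → Ω → Obs d) (S : ℕ → Ω → Fin K) (seed : Ω → 𝒰) (T : ℕ) (ω : Ω) : ℝ :=
  ∑ k : Fin K, ((fold S T k ω).card : ℝ) / (T : ℝ) *
    ((∫ x, A.muHatExcl Z S seed T k ω x ∂(densityMeasure 𝒳 q)) +
      1 / ((fold S T k ω).card : ℝ) *
        ∑ t ∈ fold S T k ω,
          inflHat q p π (A.muHatExcl Z S seed T k ω) (A.tauHatExcl Z S seed T k ω) (Z t ω))

end Estimator

/-- The random elements of the experiment: the units `(Record, Δ)` are i.i.d. with the law of the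
design, the fold labels are i.i.d. uniform on the `K` folds, and the units, the fold labels and
the seed of the learning procedures are independent of each other. -/
structure IsExperiment {d m K : ℕ} {𝒰 Ω : Type*} [MeasurableSpace 𝒰] [MeasurableSpace Ω]
    (P : Measure Ω) (𝒳 : Set (Vec d)) (p π : Vec d → ℝ) (κ : Kernel (Vec d) (Vec m × ℝ))
    (U : ℕ → Ω → Record d m × Bool) (S : ℕ → Ω → Fin K) (seed : Ω → 𝒰) : Prop where
  measurable_unit : ∀ t, Measurable (U t)
  measurable_fold : ∀ t, Measurable (S t)
  measurable_seed : Measurable seed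
  unit_law : ∀ t, P.map (U t) = unitLaw 𝒳 p π κ
  unit_indep : iIndepFun U P
  fold_law : ∀ t k, P {ω | S t ω = k} = 1 / (K : ENNReal)
  fold_indep : iIndepFun S P
  unit_indep_fold : IndepFun (fun ω t => U t ω) (fun ω t => S t ω) P
  seed_indep : IndepFun (fun ω => ((fun t => U t ω : ℕ → Record d m × Bool),
    (fun t => S t ω : ℕ → Fin K))) seed P

end PGAE

end

/-! Write w = q/p and let φ = w·(Δ/π·(Y − τ) + τ − μ) be the `influence` function. It has mean zero,
and its second moment is V: the cross term vanishes because E[Y − τ ∣ X, F] = 0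
(`influence_moments`).

Since π and p are known, for fixed μ̂ and τ̂ the difference Ψ̂ − φ has mean exactly θ − E_q[μ̂],
whatever τ̂ is. Adding E_q[μ̂] − θ therefore gives a score error with mean zero (`centeredError`).
No bias term remains, so consistency suffices and no rate is needed. The identity
`sqrt_mul_thetaHat_sub_theta` writes √T(θ̂_T − θ) as T^{-1/2} ∑ φ(U_t) plus the scaled errors of the
K folds. The first sum converges to N(0, V) by the central limit theorem.

Cross-fitting controls the second sum. Given the training observations, the labels and the seed, the
errors in a fold are i.i.d. and centred, with second moment at most E[w²(τ̂ − τ)²]/πmin + E[w²(μ̂ −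
μ)²] (`centeredError_moments`). The weight w² is integrable but possibly unbounded; truncating it
and using the bound C shows that plain mean-square accuracy makes these weighted errors small
(`exists_forall_integral_mul_sq_le`). A conditional Chebyshev inequality
(`measure_inter_le_abs_sum_le`) then sends the fold errors to zero in probability, and Slutsky's
theorem concludes. -/

namespace PGAE

open scoped ENNReal Topology

/-! ### Independence, conditional Chebyshev, and truncation of an integrable weight. -/

section Abstract

variable {Ω : Type*} [MeasurableSpace Ω] {P : Measure Ω}

/-- If `X` is independent of `Y`, and `(X, Y)` of `Z`, then `X` is independent of `(Y, Z)`. -/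
lemma indepFun_prodMk_of_indepFun_prodMk {α β γ : Type*} [MeasurableSpace α] [MeasurableSpace β]
    [MeasurableSpace γ] [IsFiniteMeasure P] {X : Ω → α} {Y : Ω → β} {Z : Ω → γ}
    (hX : Measurable X) (hY : Measurable Y) (hZ : Measurable Z)
    (hXY : IndepFun X Y P) (hXYZ : IndepFun (fun ω => (X ω, Y ω)) Z P) :
    IndepFun X (fun ω => (Y ω, Z ω)) P := by
  have hYZ : IndepFun Y Z P := hXYZ.comp measurable_snd measurable_id
  -- Both sides are reassociated forms of the law of ((X, Y), Z), which is a product of three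
  -- marginals.
  rw [indepFun_iff_map_prod_eq_prod_map_map hX.aemeasurable (hY.prodMk hZ).aemeasurable,
    hYZ.map_prod_eq_prod_map_map hY.aemeasurable hZ.aemeasurable, ← Measure.prodAssoc_prod,
    ← hXY.map_prod_eq_prod_map_map hX.aemeasurable hY.aemeasurable,
    ← hXYZ.map_prod_eq_prod_map_map (hX.prodMk hY).aemeasurable hZ.aemeasurable,
    Measure.map_map MeasurableEquiv.prodAssoc.measurable ((hX.prodMk hY).prodMk hZ)]
  rfl

/-- Chebyshev's inequality for a sum of independent centred square-integrable variables. -/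
lemma measure_le_abs_sum_le {ι E : Type*} [Fintype ι] [MeasurableSpace E] [IsProbabilityMeasure P]
    {ν : Measure E} {V : ι → Ω → E} (hV : ∀ i, Measurable (V i)) (hlaw : ∀ i, P.map (V i) = ν)
    (hind : iIndepFun V P) {g : E → ℝ} (hg : Measurable g) (hL2 : MemLp g 2 ν)
    (h0 : ∫ e, g e ∂ν = 0) {δ : ℝ} (hδ : ∫ e, g e ^ 2 ∂ν ≤ δ) {ε : ℝ} (hε : 0 < ε) :
    P {ω | ε ≤ |∑ i, g (V i ω)|} ≤ ENNReal.ofReal (Fintype.card ι * δ / ε ^ 2) := by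
  have hmem (i : ι) : MemLp (fun ω => g (V i ω)) 2 P := by
    have h := hL2
    rw [← hlaw i] at h
    exact h.comp_of_map (hV i).aemeasurable
  have hmean (i : ι) : ∫ ω, g (V i ω) ∂P = 0 := by
    rw [← h0, ← hlaw i, integral_map (hV i).aemeasurable hg.aestronglyMeasurable]
  have hvar (i : ι) : variance (fun ω => g (V i ω)) P ≤ δ := by
    rw [variance_of_integral_eq_zero (hmem i).1.aemeasurable (hmean i)]
    refine le_of_eq_of_le ?_ hδ
    rw [← hlaw i, integral_map (hV i).aemeasurable (hg.pow_const 2).aestronglyMeasurable]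
  have hsum : MemLp (∑ i, fun ω => g (V i ω)) 2 P := memLp_finsetSum' _ fun i _ => hmem i
  have hE : ∫ ω, (∑ i, fun ω => g (V i ω)) ω ∂P = 0 := by
    simp only [Finset.sum_apply]
    rw [integral_finsetSum _ fun i _ => (hmem i).integrable (by norm_num)]
    simp [hmean]
  have hch := meas_ge_le_variance_div_sq hsum hε
  rw [hE, IndepFun.variance_sum (fun i _ => hmem i)] at hch
  · simp only [Finset.sum_apply, sub_zero] at hch
    refine hch.trans (ENNReal.ofReal_le_ofReal ?_)
    gcongr
    exact (Finset.sum_le_sum fun i _ => hvar i).trans (by simp)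
  · intro i _ j _ hij
    exact (hind.indepFun hij).comp hg hg

/-- Conditional Chebyshev inequality: the summands depend on an independent random element `a`. -/
lemma measure_inter_le_abs_sum_le {ι E 𝒜 : Type*} [Fintype ι] [MeasurableSpace E]
    [MeasurableSpace 𝒜] [IsProbabilityMeasure P]
    {ν : Measure E} {V : ι → Ω → E} (hV : ∀ i, Measurable (V i)) (hlaw : ∀ i, P.map (V i) = ν)
    (hind : iIndepFun V P) {a : Ω → 𝒜} (ha : Measurable a)
    (hVa : IndepFun (fun ω i => V i ω) a P) {g : 𝒜 → E → ℝ}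
    (hg : Measurable (Function.uncurry g)) {G : Set 𝒜} (hG : MeasurableSet G)
    (hL2 : ∀ x ∈ G, MemLp (g x) 2 ν) (h0 : ∀ x ∈ G, ∫ e, g x e ∂ν = 0) {δ : ℝ}
    (hδ : ∀ x ∈ G, ∫ e, g x e ^ 2 ∂ν ≤ δ) {ε : ℝ} (hε : 0 < ε) :
    P {ω | a ω ∈ G ∧ ε ≤ |∑ i, g (a ω) (V i ω)|} ≤
      ENNReal.ofReal (Fintype.card ι * δ / ε ^ 2) * P (a ⁻¹' G) := by
  have hVm : Measurable (fun ω i => V i ω) := measurable_pi_lambda _ hV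
  let B : Set ((ι → E) × 𝒜) := {y | y.2 ∈ G ∧ ε ≤ |∑ i, g y.2 (y.1 i)|}
  have hB : MeasurableSet B := by
    have hm : Measurable fun y : (ι → E) × 𝒜 => |∑ i, g y.2 (y.1 i)| := ?_
    · exact (measurable_snd hG).inter (measurableSet_le measurable_const hm)
    refine (Finset.measurable_fun_sum _ fun i _ => ?_).abs
    exact hg.comp (measurable_snd.prodMk ((measurable_pi_apply i).comp measurable_fst))
  have hP : P {ω | a ω ∈ G ∧ ε ≤ |∑ i, g (a ω) (V i ω)|} =
      ((P.map (fun ω i => V i ω)).prod (P.map a)) B := by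
    rw [← hVa.map_prod_eq_prod_map_map hVm.aemeasurable ha.aemeasurable,
      Measure.map_apply (hVm.prodMk ha) hB]
    rfl
  have hpa : IsProbabilityMeasure (P.map a) := Measure.isProbabilityMeasure_map ha.aemeasurable
  have hpV : IsProbabilityMeasure (P.map (fun ω i => V i ω)) :=
    Measure.isProbabilityMeasure_map hVm.aemeasurable
  -- Fubini under the product law: with the value of `a` frozen, each slice in `G` obeys the
  -- unconditional bound and the other slices are empty.
  rw [hP, Measure.prod_apply_symm hB, ← Measure.map_apply ha hG,
    ← lintegral_indicator_const hG]
  refine lintegral_mono fun x => ?_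
  by_cases hx : x ∈ G
  · rw [Set.indicator_of_mem hx]
    refine le_trans (le_of_eq ?_) (measure_le_abs_sum_le hV hlaw hind
      (hg.comp measurable_prodMk_left) (hL2 x hx) (h0 x hx) (hδ x hx) hε)
    rw [Measure.map_apply hVm (measurable_prodMk_right hB)]
    congr 1
    ext ω
    simp [B, hx]
  · rw [Set.indicator_of_notMem hx]
    simp [B, hx]

lemma tendstoInMeasure_finset_sum_zero {ι : Type*} (s : Finset ι) {R : ι → ℕ → Ω → ℝ}
    (h : ∀ k ∈ s, TendstoInMeasure P (R k) atTop (fun _ => (0 : ℝ))) :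
    TendstoInMeasure P (fun T ω => ∑ k ∈ s, R k T ω) atTop (fun _ => (0 : ℝ)) := by
  classical
  induction s using Finset.induction_on with
  | empty =>
    rw [tendstoInMeasure_iff_norm]
    intro ε hε
    simp [not_le.2 hε]
  | insert k s hk ih =>
    have h1 := tendstoInMeasure_iff_norm.1 (h k (Finset.mem_insert_self _ _))
    have h2 := tendstoInMeasure_iff_norm.1 (ih fun j hj => h j (Finset.mem_insert_of_mem hj))
    rw [tendstoInMeasure_iff_norm]
    intro ε hε
    have h3 := (h1 (ε / 2) (by positivity)).add (h2 (ε / 2) (by positivity))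
    rw [add_zero] at h3
    refine tendsto_of_tendsto_of_tendsto_of_le_of_le tendsto_const_nhds h3
      (fun _ => zero_le) (fun T => ?_)
    refine (measure_mono ?_).trans (measure_union_le _ _)
    intro ω hω
    simp only [Finset.sum_insert hk, sub_zero, Set.mem_ofPred_eq, Set.mem_union] at hω ⊢
    by_contra! hc
    have := norm_add_le (R k T ω) (∑ j ∈ s, R j T ω)
    linarith

/-- A bounded function with small second moment also has a small weighted second moment. -/
lemma exists_forall_integral_mul_sq_le {ρ : Measure Ω} [IsFiniteMeasure ρ] {w : Ω → ℝ}
    (hw : Integrable w ρ) (hw0 : 0 ≤ w) (B : ℝ) {ε : ℝ} (hε : 0 < ε) :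
    ∃ δ > 0, ∀ A : Ω → ℝ, Measurable A → (∀ᵐ x ∂ρ, |A x| ≤ B) → ∫ x, A x ^ 2 ∂ρ ≤ δ →
      ∫ x, w x * A x ^ 2 ∂ρ ≤ ε := by
  have hmin (n : ℕ) : Integrable (fun x => min (w x) n) ρ := by
    refine hw.mono (hw.1.inf aestronglyMeasurable_const) (ae_of_all _ fun x => ?_)
    have : 0 ≤ min (w x) n := le_min (hw0 x) n.cast_nonneg
    rw [Real.norm_of_nonneg this, Real.norm_of_nonneg (hw0 x)]
    exact min_le_left _ _
  have hlim : Tendsto (fun n : ℕ => ∫ x, min (w x) n ∂ρ) atTop (𝓝 (∫ x, w x ∂ρ)) := by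
    refine tendsto_integral_of_dominated_convergence w (fun n => (hmin n).1) hw
      (fun n => ae_of_all _ fun x => ?_) (ae_of_all _ fun x => ?_)
    · rw [Real.norm_of_nonneg (le_min (hw0 x) n.cast_nonneg)]
      exact min_le_left _ _
    · obtain ⟨N, hN⟩ := exists_nat_ge (w x)
      refine tendsto_const_nhds.congr' ?_
      filter_upwards [eventually_ge_atTop N] with n hn
      exact (min_eq_left (hN.trans (by exact_mod_cast hn))).symm
  -- The level `n` makes B² times the truncated-off mass of `w` at most ε/2. It does not depend on
  -- `A`, so `δ` is uniform; the `+ 1`s keep the denominators positive when B = 0 or n = 0.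
  obtain ⟨n, hn⟩ := ((tendsto_order.1 hlim).1 (∫ x, w x ∂ρ - ε / (2 * (B ^ 2 + 1)))
    (sub_lt_self _ (by positivity))).exists
  refine ⟨ε / (2 * (n + 1)), by positivity, fun A hA hAB hAδ => ?_⟩
  have hA2 : ∀ᵐ x ∂ρ, A x ^ 2 ≤ B ^ 2 := by
    filter_upwards [hAB] with x hx
    exact sq_le_sq' (neg_le_of_abs_le hx) (le_of_abs_le hx)
  have hAint : Integrable (fun x => A x ^ 2) ρ := by
    refine Integrable.of_bound (hA.pow_const 2).aestronglyMeasurable (B ^ 2) ?_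
    filter_upwards [hA2] with x hx
    rwa [Real.norm_of_nonneg (sq_nonneg _)]
  have hdiff : Integrable (fun x => w x - min (w x) n) ρ := hw.sub (hmin n)
  have hint : Integrable (fun x => B ^ 2 * (w x - min (w x) n) + n * A x ^ 2) ρ :=
    (hdiff.const_mul _).add (hAint.const_mul _)
  calc ∫ x, w x * A x ^ 2 ∂ρ
      ≤ ∫ x, (B ^ 2 * (w x - min (w x) n) + n * A x ^ 2) ∂ρ := by
        refine integral_mono_of_nonneg (ae_of_all _ fun x => mul_nonneg (hw0 x) (sq_nonneg _))
          hint ?_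
        filter_upwards [hA2] with x hx
        have h1 : 0 ≤ w x - min (w x) n := sub_nonneg.2 (min_le_left _ _)
        have h2 : min (w x) (n : ℝ) ≤ n := min_le_right _ _
        -- Split w = (w − min(w, n)) + min(w, n); bound A² by B² on the first piece and the weight
        -- by n on the second.
        nlinarith [mul_le_mul_of_nonneg_left hx h1, mul_le_mul_of_nonneg_right h2 (sq_nonneg (A x))]
    _ = B ^ 2 * (∫ x, w x ∂ρ - ∫ x, min (w x) n ∂ρ) + n * ∫ x, A x ^ 2 ∂ρ := by
        rw [integral_add (hdiff.const_mul _) (hAint.const_mul _),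
          integral_const_mul, integral_const_mul, integral_sub hw (hmin n)]
    _ ≤ (B ^ 2 + 1) * (ε / (2 * (B ^ 2 + 1))) + (n + 1) * (ε / (2 * (n + 1))) := by
        have h1 : 0 ≤ ∫ x, w x ∂ρ - ∫ x, min (w x) n ∂ρ := by
          rw [← integral_sub hw (hmin n)]
          exact integral_nonneg fun x => sub_nonneg.2 (min_le_left _ _)
        have h3 : 0 ≤ ∫ x, A x ^ 2 ∂ρ := integral_nonneg fun x => sq_nonneg _
        gcongr
        · linarith
        · linarith
        · linarith
    _ = ε := by field_simp; ring

end Abstract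

/-! ### Change of measure from q to p, and integration under the law of a unit. -/

section Laws

variable {d m : ℕ} {𝒳 : Set (Vec d)} {q p π : Vec d → ℝ} {κ : Kernel (Vec d) (Vec m × ℝ)}

lemma IsDensityOn.isProbabilityMeasure {g : Vec d → ℝ} (hg : IsDensityOn 𝒳 g) :
    IsProbabilityMeasure (densityMeasure 𝒳 g) :=
  ⟨by rw [densityMeasure, withDensity_apply _ MeasurableSet.univ, Measure.restrict_univ,
    hg.lintegral_eq_one]⟩

/-- The importance weight `q(X) / p(X)` on records. -/
noncomputable def weight (m : ℕ) (q p : Vec d → ℝ) (z : Record d m) : ℝ := q z.1 / p z.1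

lemma measurable_weight (hq : Measurable q) (hp : Measurable p) : Measurable (weight m q p) :=
  (hq.comp measurable_fst).div (hp.comp measurable_fst)

lemma map_fst_recordLaw [IsMarkovKernel κ] {g : Vec d → ℝ} (hg : IsDensityOn 𝒳 g) :
    (recordLaw 𝒳 g κ).map Prod.fst = densityMeasure 𝒳 g := by
  have := hg.isProbabilityMeasure
  exact Measure.fst_compProd _ _

lemma ae_recordLaw_of_ae_restrict [IsMarkovKernel κ] {g : Vec d → ℝ} (hg : IsDensityOn 𝒳 g)
    {φ : Vec d → Prop} (h : ∀ᵐ x ∂(volume.restrict 𝒳), φ x) :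
    ∀ᵐ z ∂(recordLaw 𝒳 g κ), φ z.1 := by
  have h1 : ∀ᵐ x ∂(densityMeasure 𝒳 g), φ x := (withDensity_absolutelyContinuous _ _).ae_le h
  rw [← map_fst_recordLaw (κ := κ) hg] at h1
  exact ae_of_ae_map measurable_fst.aemeasurable h1

lemma isProbabilityMeasure_recordLaw [IsMarkovKernel κ] {g : Vec d → ℝ} (hg : IsDensityOn 𝒳 g) :
    IsProbabilityMeasure (recordLaw 𝒳 g κ) := by
  have := hg.isProbabilityMeasure
  unfold recordLaw
  infer_instance

lemma densityMeasure_eq_withDensity (hq : IsDensityOn 𝒳 q) (hp : IsDensityOn 𝒳 p)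
    (hpos : ∀ᵐ x ∂(volume.restrict 𝒳), 0 < p x) :
    densityMeasure 𝒳 q =
      (densityMeasure 𝒳 p).withDensity (fun x => ENNReal.ofReal (q x / p x)) := by
  unfold densityMeasure
  have hw : Measurable fun x => ENNReal.ofReal (q x / p x) :=
    (hq.measurable.div hp.measurable).ennreal_ofReal
  rw [← withDensity_mul _ hp.measurable.ennreal_ofReal hw]
  refine withDensity_congr_ae ?_
  filter_upwards [hpos] with x hx
  rw [Pi.mul_apply, ← ENNReal.ofReal_mul hx.le, mul_div_cancel₀ _ hx.ne']

/-- Both populations share the kernel `κ`, so reweighting the covariate marginal already reweights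
the whole record law. -/
lemma recordLaw_eq_withDensity [IsMarkovKernel κ] (hq : IsDensityOn 𝒳 q) (hp : IsDensityOn 𝒳 p)
    (hpos : ∀ᵐ x ∂(volume.restrict 𝒳), 0 < p x) :
    recordLaw 𝒳 q κ =
      (recordLaw 𝒳 p κ).withDensity (fun z => ENNReal.ofReal (weight m q p z)) := by
  have := hq.isProbabilityMeasure
  have := hp.isProbabilityMeasure
  have hw : Measurable fun x => ENNReal.ofReal (q x / p x) :=
    (hq.measurable.div hp.measurable).ennreal_ofReal
  ext s hs
  rw [withDensity_apply _ hs, ← lintegral_indicator hs]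
  unfold recordLaw
  rw [Measure.lintegral_compProd
      ((measurable_weight hq.measurable hp.measurable).ennreal_ofReal.indicator hs),
    Measure.compProd_apply hs, densityMeasure_eq_withDensity hq hp hpos,
    lintegral_withDensity_eq_lintegral_mul _ hw (Kernel.measurable_kernel_prodMk_left hs)]
  refine lintegral_congr fun x => ?_
  rw [Pi.mul_apply, ← lintegral_indicator_const (measurable_prodMk_left hs)]
  rfl

lemma integral_recordLaw_eq_integral_weight_mul [IsMarkovKernel κ] (hq : IsDensityOn 𝒳 q)
    (hp : IsDensityOn 𝒳 p) (hpos : ∀ᵐ x ∂(volume.restrict 𝒳), 0 < p x) (h : Record d m → ℝ) :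
    ∫ z, h z ∂(recordLaw 𝒳 q κ) = ∫ z, weight m q p z * h z ∂(recordLaw 𝒳 p κ) := by
  rw [recordLaw_eq_withDensity hq hp hpos, integral_withDensity_eq_integral_toReal_smul
    (measurable_weight hq.measurable hp.measurable).ennreal_ofReal
    (ae_of_all _ fun _ => ENNReal.ofReal_lt_top)]
  refine integral_congr_ae ?_
  filter_upwards [ae_recordLaw_of_ae_restrict (κ := κ) hp hpos,
    ae_recordLaw_of_ae_restrict (κ := κ) hp hq.nonneg] with z h1 h2
  rw [ENNReal.toReal_ofReal (show 0 ≤ weight m q p z from div_nonneg h2 h1.le), smul_eq_mul]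

lemma integral_densityMeasure_eq_integral_weight_mul (κ : Kernel (Vec d) (Vec m × ℝ))
    [IsMarkovKernel κ] (hq : IsDensityOn 𝒳 q)
    (hp : IsDensityOn 𝒳 p) (hpos : ∀ᵐ x ∂(volume.restrict 𝒳), 0 < p x) {h : Vec d → ℝ}
    (hh : Measurable h) :
    ∫ x, h x ∂(densityMeasure 𝒳 q) = ∫ z, weight m q p z * h z.1 ∂(recordLaw 𝒳 p κ) := by
  rw [← integral_recordLaw_eq_integral_weight_mul hq hp hpos (fun z => h z.1),
    ← map_fst_recordLaw (κ := κ) hq,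
    integral_map measurable_fst.aemeasurable hh.aestronglyMeasurable]

/-- Splitting on the value of Δ turns unit expectations into two integrals over records, weighted by
π and 1 − π. -/
lemma unitLaw_eq_add (hπ : Measurable π) [SFinite (recordLaw 𝒳 p κ)] :
    unitLaw 𝒳 p π κ =
      ((recordLaw 𝒳 p κ).withDensity (fun z => ENNReal.ofReal (π z.1))).map (fun z => (z, true)) +
      ((recordLaw 𝒳 p κ).withDensity (fun z => ENNReal.ofReal (1 - π z.1))).map
        (fun z => (z, false)) := by
  have hm : Measurable fun u : Record d m × Bool =>
      ENNReal.ofReal (if u.2 then π u.1.1 else 1 - π u.1.1) := by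
    refine (Measurable.ite (measurable_snd (measurableSet_singleton true)) ?_ ?_).ennreal_ofReal
    · exact hπ.comp (measurable_fst.comp measurable_fst)
    · exact measurable_const.sub (hπ.comp (measurable_fst.comp measurable_fst))
  ext s hs
  have h1 : MeasurableSet ((fun z : Record d m => (z, true)) ⁻¹' s) := measurable_prodMk_right hs
  have h2 : MeasurableSet ((fun z : Record d m => (z, false)) ⁻¹' s) := measurable_prodMk_right hs
  rw [Measure.add_apply, Measure.map_apply measurable_prodMk_right hs,
    Measure.map_apply measurable_prodMk_right hs, withDensity_apply _ h1, withDensity_apply _ h2,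
    ← lintegral_indicator h1, ← lintegral_indicator h2, unitLaw, withDensity_apply _ hs,
    ← lintegral_indicator hs, lintegral_prod _ (hm.indicator hs).aemeasurable,
    ← lintegral_add_left]
  · refine lintegral_congr fun z => ?_
    rw [lintegral_count, tsum_fintype, Fintype.sum_bool]
    rfl
  · exact (hπ.comp measurable_fst).ennreal_ofReal.indicator h1

/-- Expectations under the law of a unit: `Δ` is integrated out. -/
lemma integral_unitLaw [IsMarkovKernel κ] (hp : IsDensityOn 𝒳 p) (hπ : Measurable π)
    (hπ0 : ∀ᵐ x ∂(volume.restrict 𝒳), 0 ≤ π x) (hπ1 : ∀ᵐ x ∂(volume.restrict 𝒳), π x ≤ 1)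
    {h : Record d m × Bool → ℝ} (hh : Measurable h) {b : Record d m → ℝ}
    (hb : Integrable b (recordLaw 𝒳 p κ))
    (hhb : ∀ᵐ z ∂(recordLaw 𝒳 p κ), ∀ δ, |h (z, δ)| ≤ b z) :
    Integrable h (unitLaw 𝒳 p π κ) ∧
    ∫ u, h u ∂(unitLaw 𝒳 p π κ) =
      ∫ z, (π z.1 * h (z, true) + (1 - π z.1) * h (z, false)) ∂(recordLaw 𝒳 p κ) := by
  have := isProbabilityMeasure_recordLaw (κ := κ) hp
  have hπm : Measurable fun z : Record d m => ENNReal.ofReal (π z.1) :=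
    (hπ.comp measurable_fst).ennreal_ofReal
  have hπm' : Measurable fun z : Record d m => ENNReal.ofReal (1 - π z.1) :=
    (measurable_const.sub (hπ.comp measurable_fst)).ennreal_ofReal
  have hfin (g : Record d m → ℝ) : ∀ᵐ z ∂(recordLaw 𝒳 p κ), ENNReal.ofReal (g z) < ⊤ :=
    ae_of_all _ fun _ => ENNReal.ofReal_lt_top
  have e0 := ae_recordLaw_of_ae_restrict (κ := κ) hp hπ0
  have e1 := ae_recordLaw_of_ae_restrict (κ := κ) hp hπ1
  have ht : Measurable fun z => h (z, true) := hh.comp measurable_prodMk_right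
  have hf : Measurable fun z => h (z, false) := hh.comp measurable_prodMk_right
  have it : Integrable (fun z => (ENNReal.ofReal (π z.1)).toReal • h (z, true))
      (recordLaw 𝒳 p κ) := by
    refine hb.mono' (hπm.ennreal_toReal.smul ht).aestronglyMeasurable ?_
    filter_upwards [hhb, e0, e1] with z hz h0 h1
    rw [ENNReal.toReal_ofReal h0, smul_eq_mul, Real.norm_eq_abs, abs_mul, abs_of_nonneg h0]
    exact (mul_le_of_le_one_left (abs_nonneg _) h1).trans (hz true)
  have iF : Integrable (fun z => (ENNReal.ofReal (1 - π z.1)).toReal • h (z, false))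
      (recordLaw 𝒳 p κ) := by
    refine hb.mono' (hπm'.ennreal_toReal.smul hf).aestronglyMeasurable ?_
    filter_upwards [hhb, e0, e1] with z hz h0 h1
    rw [ENNReal.toReal_ofReal (by linarith), smul_eq_mul, Real.norm_eq_abs, abs_mul,
      abs_of_nonneg (by linarith)]
    exact (mul_le_of_le_one_left (abs_nonneg _) (by linarith)).trans (hz false)
  have it' := (integrable_map_measure (g := h) (f := fun z : Record d m => (z, true))
    hh.aestronglyMeasurable measurable_prodMk_right.aemeasurable).2
    ((integrable_withDensity_iff_integrable_smul' hπm (hfin _)).2 it)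
  have iF' := (integrable_map_measure (g := h) (f := fun z : Record d m => (z, false))
    hh.aestronglyMeasurable measurable_prodMk_right.aemeasurable).2
    ((integrable_withDensity_iff_integrable_smul' hπm' (hfin _)).2 iF)
  rw [unitLaw_eq_add hπ]
  refine ⟨it'.add_measure iF', ?_⟩
  rw [integral_add_measure it' iF',
    integral_map measurable_prodMk_right.aemeasurable hh.aestronglyMeasurable,
    integral_map measurable_prodMk_right.aemeasurable hh.aestronglyMeasurable,
    integral_withDensity_eq_integral_toReal_smul hπm (hfin _),
    integral_withDensity_eq_integral_toReal_smul hπm' (hfin _), ← integral_add it iF]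
  refine integral_congr_ae ?_
  filter_upwards [e0, e1] with z h0 h1
  rw [ENNReal.toReal_ofReal h0, ENNReal.toReal_ofReal (by linarith), smul_eq_mul, smul_eq_mul]

end Laws

/-! ### Moments of inverse-probability-weighted scores and the efficiency bound. -/

section Scores

variable {d m : ℕ} {𝒳 : Set (Vec d)} {q p π : Vec d → ℝ} {κ : Kernel (Vec d) (Vec m × ℝ)}
  {πmin : ℝ}

/-- The standing assumptions on the population density `q` and the design `(p, π)`. -/
structure IsRegularDesign (𝒳 : Set (Vec d)) (q p π : Vec d → ℝ) (πmin : ℝ) : Prop where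
  density_q : IsDensityOn 𝒳 q
  density_p : IsDensityOn 𝒳 p
  measurable_π : Measurable π
  p_pos : ∀ᵐ x ∂(volume.restrict 𝒳), 0 < p x
  πmin_pos : 0 < πmin
  π_ge : ∀ᵐ x ∂(volume.restrict 𝒳), πmin ≤ π x
  π_le : ∀ᵐ x ∂(volume.restrict 𝒳), π x ≤ 1
  integrable_sq : Integrable (fun x => (q x / p x) ^ 2) (densityMeasure 𝒳 p)

namespace IsRegularDesign

lemma measurable_weight (hD : IsRegularDesign 𝒳 q p π πmin) : Measurable (weight m q p) :=
  PGAE.measurable_weight hD.density_q.measurable hD.density_p.measurable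

lemma integrable_weight_sq (hD : IsRegularDesign 𝒳 q p π πmin) [IsMarkovKernel κ] :
    Integrable (fun z => weight m q p z ^ 2) (recordLaw 𝒳 p κ) := by
  have h := hD.integrable_sq
  rw [← map_fst_recordLaw (κ := κ) hD.density_p] at h
  exact h.comp_measurable measurable_fst

lemma memLp_weight (hD : IsRegularDesign 𝒳 q p π πmin) [IsMarkovKernel κ] :
    MemLp (weight m q p) 2 (recordLaw 𝒳 p κ) :=
  (memLp_two_iff_integrable_sq hD.measurable_weight.aestronglyMeasurable).2
    hD.integrable_weight_sq

lemma integrable_weight (hD : IsRegularDesign 𝒳 q p π πmin) [IsMarkovKernel κ] :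
    Integrable (weight m q p) (recordLaw 𝒳 p κ) := by
  have := isProbabilityMeasure_recordLaw (κ := κ) hD.density_p
  exact hD.memLp_weight.integrable (by norm_num)

lemma ae_π (hD : IsRegularDesign 𝒳 q p π πmin) [IsMarkovKernel κ] :
    ∀ᵐ z ∂(recordLaw 𝒳 p κ), πmin ≤ π z.1 ∧ π z.1 ≤ 1 :=
  ae_recordLaw_of_ae_restrict hD.density_p (hD.π_ge.and hD.π_le)

end IsRegularDesign

/-- Scores of the form `q(X)/p(X) · (Δ/π(X) · A + B)`. -/
noncomputable def ipwScore (q p π : Vec d → ℝ) (A B : Record d m → ℝ) (u : Record d m × Bool) : ℝ :=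
  weight m q p u.1 * (ind u.2 / π u.1.1 * A u.1 + B u.1)

lemma measurable_ind : Measurable ind := measurable_of_countable _

lemma measurable_ipwScore (hD : IsRegularDesign 𝒳 q p π πmin) {A B : Record d m → ℝ}
    (hA : Measurable A) (hB : Measurable B) : Measurable (ipwScore q p π A B) :=
  (hD.measurable_weight.comp measurable_fst).mul
    ((((measurable_ind.comp measurable_snd).div
      (hD.measurable_π.comp (measurable_fst.comp measurable_fst))).mul
        (hA.comp measurable_fst)).add (hB.comp measurable_fst))

lemma integrable_mul_of_ae_abs_le {α : Type*} [MeasurableSpace α] {ρ : Measure α} {s g : α → ℝ}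
    {b : ℝ} (hs : Integrable s ρ) (hg : Measurable g) (hb : ∀ᵐ x ∂ρ, |g x| ≤ b) :
    Integrable (fun x => s x * g x) ρ :=
  hs.mul_bdd hg.aestronglyMeasurable hb

/-- Given the record, Δ has mean π and Δ² = Δ, so Δ/π has conditional mean 1 and conditional second
moment 1/π. Scores are dominated by a constant times the square-integrable weight. -/
lemma ipwScore_moments [IsMarkovKernel κ] (hD : IsRegularDesign 𝒳 q p π πmin)
    {A B : Record d m → ℝ} (hA : Measurable A) (hB : Measurable B) {a b : ℝ}
    (hAa : ∀ᵐ z ∂(recordLaw 𝒳 p κ), |A z| ≤ a) (hBb : ∀ᵐ z ∂(recordLaw 𝒳 p κ), |B z| ≤ b) :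
    MemLp (ipwScore q p π A B) 2 (unitLaw 𝒳 p π κ) ∧
    ∫ u, ipwScore q p π A B u ∂(unitLaw 𝒳 p π κ) =
      ∫ z, weight m q p z * (A z + B z) ∂(recordLaw 𝒳 p κ) ∧
    ∫ u, ipwScore q p π A B u ^ 2 ∂(unitLaw 𝒳 p π κ) =
      ∫ z, weight m q p z ^ 2 * (1 / π z.1 * A z ^ 2 + 2 * (A z * B z) + B z ^ 2)
        ∂(recordLaw 𝒳 p κ) := by
  have hm := measurable_ipwScore hD hA hB
  have hπ0 : ∀ᵐ x ∂(volume.restrict 𝒳), 0 ≤ π x := by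
    filter_upwards [hD.π_ge] with x hx using hD.πmin_pos.le.trans hx
  have hbd : ∀ᵐ z ∂(recordLaw 𝒳 p κ), ∀ δ,
      |ipwScore q p π A B (z, δ)| ≤ |weight m q p z| * (1 / πmin * a + b) := by
    filter_upwards [hAa, hBb, hD.ae_π] with z hAz hBz hπz δ
    have hpos := hD.πmin_pos
    have h1 : |ind δ / π z.1| ≤ 1 / πmin := by
      cases δ
      · simpa [ind] using hpos.le
      · simp only [ind, if_true, abs_of_pos (one_div_pos.2 (hpos.trans_le hπz.1))]
        exact one_div_le_one_div_of_le hpos hπz.1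
    unfold ipwScore
    rw [abs_mul]
    gcongr
    refine (abs_add_le _ _).trans ?_
    rw [abs_mul]
    gcongr
  obtain ⟨-, h1⟩ := integral_unitLaw hD.density_p hD.measurable_π hπ0 hD.π_le hm
    (hD.integrable_weight.abs.mul_const (1 / πmin * a + b)) hbd
  obtain ⟨h3, h4⟩ := integral_unitLaw hD.density_p hD.measurable_π hπ0 hD.π_le (hm.pow_const 2)
    (hD.integrable_weight_sq.mul_const ((1 / πmin * a + b) ^ 2)) (by
      filter_upwards [hbd] with z hz δ
      rw [abs_pow, ← sq_abs (weight m q p z), ← mul_pow]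
      exact pow_le_pow_left₀ (abs_nonneg _) (hz δ) 2)
  refine ⟨(memLp_two_iff_integrable_sq hm.aestronglyMeasurable).2 h3, h1.trans ?_, h4.trans ?_⟩
  · refine integral_congr_ae ?_
    filter_upwards [hD.ae_π] with z hz
    have : π z.1 ≠ 0 := (hD.πmin_pos.trans_le hz.1).ne'
    simp only [ipwScore, ind, if_true, Bool.false_eq_true, if_false]
    field_simp
    ring
  · refine integral_congr_ae ?_
    filter_upwards [hD.ae_π] with z hz
    have : π z.1 ≠ 0 := (hD.πmin_pos.trans_le hz.1).ne'
    simp only [ipwScore, ind, if_true, Bool.false_eq_true, if_false]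
    field_simp
    ring

lemma integral_mul_condExp {α : Type*} {m₁ m₀ : MeasurableSpace α} {ρ : Measure α} (hm : m₁ ≤ m₀)
    [SigmaFinite (ρ.trim hm)] {s g : α → ℝ} (hs : StronglyMeasurable[m₁] s)
    (hsg : Integrable (s * g) ρ) (hg : Integrable g ρ) :
    ∫ x, s x * (ρ[g | m₁]) x ∂ρ = ∫ x, s x * g x ∂ρ := by
  have h := integral_condExp hm (μ := ρ) (f := s * g)
  rw [integral_congr_ae (condExp_mul_of_stronglyMeasurable_left hs hsg hg)] at h
  exact h

lemma sigmaX_le : sigmaX d m ≤ (inferInstance : MeasurableSpace (Record d m)) := measurable_fst.comap_le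

lemma measurable_pred {f : Vec d × Vec m → ℝ} (hf : Measurable f) : Measurable (pred (d := d) f) :=
  hf.comp (measurable_fst.prodMk (measurable_fst.comp measurable_snd))

lemma sigmaXF_le {f : Vec d × Vec m → ℝ} (hf : Measurable f) :
    sigmaXF f ≤ (inferInstance : MeasurableSpace (Record d m)) :=
  (measurable_fst.prodMk (measurable_pred hf)).comap_le

lemma sigmaX_le_sigmaXF (f : Vec d × Vec m → ℝ) : sigmaX d m ≤ sigmaXF f := by
  have h : Measurable[sigmaXF f] (fun z : Record d m => (z.1, pred f z)) :=
    comap_measurable _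
  exact (measurable_fst.comp h).comap_le

lemma measurable_outcome : Measurable (outcome (d := d) (m := m)) :=
  measurable_snd.comp measurable_snd

lemma measurable_mu (P : Measure (Record d m)) : Measurable (mu P) :=
  stronglyMeasurable_condExp.measurable.mono sigmaX_le le_rfl

lemma measurable_tau {f : Vec d × Vec m → ℝ} (hf : Measurable f) (P : Measure (Record d m)) :
    Measurable (tau f P) :=
  stronglyMeasurable_condExp.measurable.mono (sigmaXF_le hf) le_rfl

lemma measurable_comp_fst_sigmaX {g : Vec d → ℝ} (hg : Measurable g) :
    Measurable[sigmaX d m] (fun z : Record d m => g z.1) :=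
  hg.comp (comap_measurable _)

/-- The efficient influence function. -/
noncomputable def influence (𝒳 : Set (Vec d)) (q p π : Vec d → ℝ)
    (κ : Kernel (Vec d) (Vec m × ℝ)) (f : Vec d × Vec m → ℝ) : Record d m × Bool → ℝ :=
  ipwScore q p π (fun z => outcome z - tau f (recordLaw 𝒳 p κ) z)
    (fun z => tau f (recordLaw 𝒳 p κ) z - mu (recordLaw 𝒳 p κ) z)

variable {f : Vec d × Vec m → ℝ} {C : ℝ}

lemma integrable_of_ae_abs_le [IsMarkovKernel κ] (hp : IsDensityOn 𝒳 p) {g : Record d m → ℝ}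
    (hg : Measurable g) (hb : ∀ᵐ z ∂(recordLaw 𝒳 p κ), |g z| ≤ C) :
    Integrable g (recordLaw 𝒳 p κ) := by
  have := isProbabilityMeasure_recordLaw (κ := κ) hp
  exact Integrable.of_bound hg.aestronglyMeasurable C hb

lemma ae_abs_sub_le {α : Type*} [MeasurableSpace α] {ρ : Measure α} {g h : α → ℝ}
    (hg : ∀ᵐ x ∂ρ, |g x| ≤ C) (hh : ∀ᵐ x ∂ρ, |h x| ≤ C) : ∀ᵐ x ∂ρ, |g x - h x| ≤ C + C := by
  filter_upwards [hg, hh] with x h1 h2 using (abs_sub _ _).trans (add_le_add h1 h2)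

/-- The weight is σ(X)-measurable, so the conditional expectation can be undone under the integral;
the weight then converts p-expectations into q-expectations. -/
lemma integral_weight_mul_mu [IsMarkovKernel κ] (hD : IsRegularDesign 𝒳 q p π πmin)
    (hY : ∀ᵐ z ∂(recordLaw 𝒳 p κ), |outcome z| ≤ C) :
    ∫ z, weight m q p z * mu (recordLaw 𝒳 p κ) z ∂(recordLaw 𝒳 p κ) = theta 𝒳 q κ := by
  have := isProbabilityMeasure_recordLaw (κ := κ) hD.density_p
  rw [theta, integral_recordLaw_eq_integral_weight_mul hD.density_q hD.density_p hD.p_pos]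
  exact integral_mul_condExp sigmaX_le
    (measurable_comp_fst_sigmaX
      (hD.density_q.measurable.div hD.density_p.measurable)).stronglyMeasurable
    (integrable_mul_of_ae_abs_le hD.integrable_weight measurable_outcome hY)
    (integrable_of_ae_abs_le hD.density_p measurable_outcome hY)

/-- The two squares in the second moment are integrals of w²/π·(Y − τ)² and w²(τ − μ)²; conditioning
on X turns them into the two terms of V. In the cross term, w²(τ − μ) is σ(X, F)-measurable and thus
orthogonal to Y − τ. -/
lemma influence_moments [IsMarkovKernel κ] (hD : IsRegularDesign 𝒳 q p π πmin) (hf : Measurable f)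
    (hY : ∀ᵐ z ∂(recordLaw 𝒳 p κ), |outcome z| ≤ C)
    (hμ : ∀ᵐ z ∂(recordLaw 𝒳 p κ), |mu (recordLaw 𝒳 p κ) z| ≤ C)
    (hτ : ∀ᵐ z ∂(recordLaw 𝒳 p κ), |tau f (recordLaw 𝒳 p κ) z| ≤ C) :
    MemLp (influence 𝒳 q p π κ f) 2 (unitLaw 𝒳 p π κ) ∧
    ∫ u, influence 𝒳 q p π κ f u ∂(unitLaw 𝒳 p π κ) = 0 ∧
    Integrable (boundIntegrand 𝒳 q p π κ f) (recordLaw 𝒳 p κ) ∧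
    ∫ u, influence 𝒳 q p π κ f u ^ 2 ∂(unitLaw 𝒳 p π κ) = effBound 𝒳 q p π κ f := by
  have := isProbabilityMeasure_recordLaw (κ := κ) hD.density_p
  set ρ := recordLaw 𝒳 p κ with hρ
  have mY : Measurable (outcome (d := d) (m := m)) := measurable_outcome
  have mμ := measurable_mu ρ
  have mτ := measurable_tau hf ρ
  have iY := integrable_of_ae_abs_le hD.density_p mY hY
  have bA := ae_abs_sub_le hY hτ
  have bB := ae_abs_sub_le hτ hμ
  have mA : Measurable fun z => outcome z - tau f ρ z := mY.sub mτ
  have mB : Measurable fun z => tau f ρ z - mu ρ z := mτ.sub mμ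
  obtain ⟨h1, h2, h3⟩ := ipwScore_moments hD mA mB bA bB
  have sq_bd {g : Record d m → ℝ} (hg : ∀ᵐ z ∂ρ, |g z| ≤ C + C) :
      ∀ᵐ z ∂ρ, |g z ^ 2| ≤ (C + C) ^ 2 := by
    filter_upwards [hg] with z hz
    rw [abs_pow]
    exact pow_le_pow_left₀ (abs_nonneg _) hz 2
  have iw2 : Integrable (fun z => weight m q p z ^ 2) ρ := hD.integrable_weight_sq
  have mwX : Measurable[sigmaX d m] (fun z : Record d m => weight m q p z ^ 2) :=
    measurable_comp_fst_sigmaX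
      ((hD.density_q.measurable.div hD.density_p.measurable).pow_const 2)
  have mwπX : Measurable[sigmaX d m] (fun z : Record d m => weight m q p z ^ 2 * (1 / π z.1)) :=
    measurable_comp_fst_sigmaX
      (((hD.density_q.measurable.div hD.density_p.measurable).pow_const 2).mul
        (measurable_const.div hD.measurable_π))
  have iwπ : Integrable (fun z => weight m q p z ^ 2 * (1 / π z.1)) ρ := by
    refine integrable_mul_of_ae_abs_le (b := 1 / πmin) iw2
      (measurable_const.div (hD.measurable_π.comp measurable_fst)) ?_
    filter_upwards [hD.ae_π] with z hz
    rw [abs_of_pos (one_div_pos.2 (hD.πmin_pos.trans_le hz.1))]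
    exact one_div_le_one_div_of_le hD.πmin_pos hz.1
  have iA2 := integrable_of_ae_abs_le hD.density_p (mA.pow_const 2) (sq_bd bA)
  have iB2 := integrable_of_ae_abs_le hD.density_p (mB.pow_const 2) (sq_bd bB)
  have iwA := integrable_mul_of_ae_abs_le iwπ (mA.pow_const 2) (sq_bd bA)
  have iwB := integrable_mul_of_ae_abs_le iw2 (mB.pow_const 2) (sq_bd bB)
  have iwB1 := integrable_mul_of_ae_abs_le iw2 mB bB
  have iwBA := integrable_mul_of_ae_abs_le iwB1 mA bA
  -- the cross term vanishes
  have hcross : ∫ z, weight m q p z ^ 2 * (tau f ρ z - mu ρ z) * (outcome z - tau f ρ z) ∂ρ = 0 := by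
    have hs : StronglyMeasurable[sigmaXF f]
        (fun z => weight m q p z ^ 2 * (tau f ρ z - mu ρ z)) :=
      (mwX.mono (sigmaX_le_sigmaXF f) le_rfl).stronglyMeasurable.mul
        (stronglyMeasurable_condExp.sub
          (stronglyMeasurable_condExp.mono (sigmaX_le_sigmaXF f)))
    have h := integral_mul_condExp (sigmaXF_le hf) hs
      (integrable_mul_of_ae_abs_le iwB1 mY hY) iY
    simp only [mul_sub _ (outcome _)]
    rw [integral_sub (integrable_mul_of_ae_abs_le iwB1 mY hY)
      (integrable_mul_of_ae_abs_le iwB1 mτ hτ), ← h]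
    exact sub_self _
  -- the bound integrand, up to conditional expectations given `X`
  have eA : (fun z => weight m q p z ^ 2 * (1 / π z.1)) *
        ρ[fun z => (outcome z - tau f ρ z) ^ 2 | sigmaX d m] =ᵐ[ρ]
      ρ[(fun z => weight m q p z ^ 2 * (1 / π z.1)) *
        (fun z => (outcome z - tau f ρ z) ^ 2) | sigmaX d m] :=
    (condExp_mul_of_stronglyMeasurable_left mwπX.stronglyMeasurable iwA iA2).symm
  have eB : (fun z => weight m q p z ^ 2) *
        ρ[fun z => (tau f ρ z - mu ρ z) ^ 2 | sigmaX d m] =ᵐ[ρ]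
      ρ[(fun z => weight m q p z ^ 2) *
        (fun z => (tau f ρ z - mu ρ z) ^ 2) | sigmaX d m] :=
    (condExp_mul_of_stronglyMeasurable_left mwX.stronglyMeasurable iwB iB2).symm
  have tA : ρ[condVar (sigmaXF f) outcome ρ | sigmaX d m] =ᵐ[ρ]
      ρ[fun z => (outcome z - tau f ρ z) ^ 2 | sigmaX d m] :=
    condExp_condExp_of_le (sigmaX_le_sigmaXF f) (sigmaXF_le hf)
  -- The conditional variance of τ is centred at E[τ ∣ X], which the tower property identifies with
  -- μ.
  have tμ : ρ[tau f ρ | sigmaX d m] =ᵐ[ρ] mu ρ :=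
    condExp_condExp_of_le (sigmaX_le_sigmaXF f) (sigmaXF_le hf)
  have tB : condVar (sigmaX d m) (tau f ρ) ρ =ᵐ[ρ]
      ρ[fun z => (tau f ρ z - mu ρ z) ^ 2 | sigmaX d m] := by
    refine condExp_congr_ae ?_
    filter_upwards [tμ] with z hz
    simp only [Pi.pow_apply, Pi.sub_apply, hz]
  have hbI : boundIntegrand 𝒳 q p π κ f =ᵐ[ρ]
      ρ[(fun z => weight m q p z ^ 2 * (1 / π z.1)) *
        (fun z => (outcome z - tau f ρ z) ^ 2) | sigmaX d m] +
      ρ[(fun z => weight m q p z ^ 2) *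
        (fun z => (tau f ρ z - mu ρ z) ^ 2) | sigmaX d m] := by
    filter_upwards [eA, eB, tA, tB] with z h1 h2 h3 h4
    rw [Pi.add_apply, ← h1, ← h2, Pi.mul_apply, Pi.mul_apply, ← h3, ← h4, boundIntegrand,
      ← div_pow]
    simp only [weight, ← hρ]
    ring
  refine ⟨h1, h2.trans ?_, (integrable_condExp.add integrable_condExp).congr hbI.symm,
    h3.trans ?_⟩
  · simp only [sub_add_sub_cancel, mul_sub]
    rw [integral_sub (integrable_mul_of_ae_abs_le hD.integrable_weight mY hY)
      (integrable_mul_of_ae_abs_le hD.integrable_weight mμ hμ),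
      integral_weight_mul_mu hD hY,
      ← integral_recordLaw_eq_integral_weight_mul hD.density_q hD.density_p hD.p_pos]
    exact sub_self _
  · rw [effBound, integral_congr_ae hbI, integral_add' integrable_condExp integrable_condExp,
      integral_condExp sigmaX_le, integral_condExp sigmaX_le]
    have hsplit (z : Record d m) : weight m q p z ^ 2 *
        (1 / π z.1 * (outcome z - tau f ρ z) ^ 2 +
          2 * ((outcome z - tau f ρ z) * (tau f ρ z - mu ρ z)) + (tau f ρ z - mu ρ z) ^ 2) =
        (weight m q p z ^ 2 * (1 / π z.1) * (outcome z - tau f ρ z) ^ 2 +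
          weight m q p z ^ 2 * (tau f ρ z - mu ρ z) ^ 2) +
          2 * (weight m q p z ^ 2 * (tau f ρ z - mu ρ z) * (outcome z - tau f ρ z)) := by
      ring
    simp only [hsplit]
    have iAB : Integrable (fun z => weight m q p z ^ 2 * (1 / π z.1) * (outcome z - tau f ρ z) ^ 2 +
        weight m q p z ^ 2 * (tau f ρ z - mu ρ z) ^ 2) ρ := iwA.add iwB
    rw [integral_add iAB (iwBA.const_mul 2), integral_const_mul, hcross, mul_zero,
      add_zero, integral_add iwA iwB]
    rfl

end Scores

/-! ### Score error for fixed nuisance estimates. -/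

section CenteredError

variable {d m : ℕ} {𝒳 : Set (Vec d)} {q p π : Vec d → ℝ} {κ : Kernel (Vec d) (Vec m × ℝ)}
  {πmin C : ℝ} {f : Vec d × Vec m → ℝ}

/-- The error of the estimated influence function, centred for fixed estimates of `μ` and `τ`. -/
noncomputable def centeredError (𝒳 : Set (Vec d)) (q p π : Vec d → ℝ)
    (κ : Kernel (Vec d) (Vec m × ℝ)) (f : Vec d × Vec m → ℝ) (mhat : Vec d → ℝ)
    (that : Vec d → ℝ → ℝ) (u : Record d m × Bool) : ℝ :=
  inflHat q p π mhat that (observe f u) - influence 𝒳 q p π κ f u +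
    (∫ x, mhat x ∂(densityMeasure 𝒳 q) - theta 𝒳 q κ)

lemma ae_unitLaw_of_ae_recordLaw [SFinite (recordLaw 𝒳 p κ)] {φ : Record d m → Prop}
    (h : ∀ᵐ z ∂(recordLaw 𝒳 p κ), φ z) : ∀ᵐ u ∂(unitLaw 𝒳 p π κ), φ u.1 :=
  (withDensity_absolutelyContinuous _ _).ae_le (Measure.quasiMeasurePreserving_fst.ae h)

lemma measurable_observe (hf : Measurable f) : Measurable (observe (d := d) f) := by
  have h1 : Measurable fun u : Record d m × Bool => pred f u.1 :=
    (measurable_pred hf).comp measurable_fst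
  have h2 : Measurable fun u : Record d m × Bool => ind u.2 * outcome u.1 :=
    (measurable_ind.comp measurable_snd).mul (measurable_outcome.comp measurable_fst)
  exact (measurable_fst.comp measurable_fst).prodMk (h1.prodMk (measurable_snd.prodMk h2))

/-- Y cancels, leaving a score with A = τ − τ̂ and A + B = μ − μ̂. Hence its mean does not involve
τ̂. -/
lemma inflHat_observe_sub_influence {mhat : Vec d → ℝ} {that : Vec d → ℝ → ℝ}
    {u : Record d m × Bool} (hu : π u.1.1 ≠ 0) :
    inflHat q p π mhat that (observe f u) - influence 𝒳 q p π κ f u =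
      ipwScore q p π (fun z => tau f (recordLaw 𝒳 p κ) z - that z.1 (pred f z))
        (fun z => (that z.1 (pred f z) - tau f (recordLaw 𝒳 p κ) z) -
          (mhat z.1 - mu (recordLaw 𝒳 p κ) z)) u := by
  simp only [inflHat, observe, influence, ipwScore, weight, mul_comm (π u.1.1) (p u.1.1),
    ← div_div]
  generalize q u.1.1 / p u.1.1 = w
  field_simp
  ring

/-- The centred error has mean zero, and a second moment controlled by the weighted mean square
errors of the estimates. -/
lemma centeredError_moments [IsMarkovKernel κ] (hD : IsRegularDesign 𝒳 q p π πmin)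
    [IsProbabilityMeasure (unitLaw 𝒳 p π κ)]
    (hf : Measurable f) (hY : ∀ᵐ z ∂(recordLaw 𝒳 p κ), |outcome z| ≤ C)
    (hμ : ∀ᵐ z ∂(recordLaw 𝒳 p κ), |mu (recordLaw 𝒳 p κ) z| ≤ C)
    (hτ : ∀ᵐ z ∂(recordLaw 𝒳 p κ), |tau f (recordLaw 𝒳 p κ) z| ≤ C)
    {mhat : Vec d → ℝ} {that : Vec d → ℝ → ℝ} (hm : Measurable mhat)
    (ht : Measurable (Function.uncurry that))
    (hmC : ∀ᵐ z ∂(recordLaw 𝒳 p κ), |mhat z.1| ≤ C)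
    (htC : ∀ᵐ z ∂(recordLaw 𝒳 p κ), |that z.1 (pred f z)| ≤ C) :
    MemLp (centeredError 𝒳 q p π κ f mhat that) 2 (unitLaw 𝒳 p π κ) ∧
    ∫ u, centeredError 𝒳 q p π κ f mhat that u ∂(unitLaw 𝒳 p π κ) = 0 ∧
    ∫ u, centeredError 𝒳 q p π κ f mhat that u ^ 2 ∂(unitLaw 𝒳 p π κ) ≤
      1 / πmin * ∫ z, weight m q p z ^ 2 *
        (that z.1 (pred f z) - tau f (recordLaw 𝒳 p κ) z) ^ 2 ∂(recordLaw 𝒳 p κ) +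
      ∫ z, weight m q p z ^ 2 *
        (mhat z.1 - mu (recordLaw 𝒳 p κ) z) ^ 2 ∂(recordLaw 𝒳 p κ) := by
  have := isProbabilityMeasure_recordLaw (κ := κ) hD.density_p
  set ρ := recordLaw 𝒳 p κ with hρ
  set ν := unitLaw 𝒳 p π κ with hν
  have mM : Measurable fun z : Record d m => mhat z.1 := hm.comp measurable_fst
  have mT : Measurable fun z : Record d m => that z.1 (pred f z) :=
    ht.comp (measurable_fst.prodMk (measurable_pred hf))
  have mdM : Measurable fun z => mhat z.1 - mu ρ z := mM.sub (measurable_mu ρ)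
  have mdT : Measurable fun z => that z.1 (pred f z) - tau f ρ z := mT.sub (measurable_tau hf ρ)
  have bdM := ae_abs_sub_le hmC hμ
  have bdT := ae_abs_sub_le htC hτ
  obtain ⟨h1, h2, h3⟩ := ipwScore_moments (A := fun z => tau f ρ z - that z.1 (pred f z))
    (B := fun z => (that z.1 (pred f z) - tau f ρ z) - (mhat z.1 - mu ρ z))
    hD ((measurable_tau hf ρ).sub mT) (mdT.sub mdM) (ae_abs_sub_le hτ htC) (ae_abs_sub_le bdT bdM)
  set D := ipwScore q p π (fun z => tau f ρ z - that z.1 (pred f z))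
    (fun z => (that z.1 (pred f z) - tau f ρ z) - (mhat z.1 - mu ρ z)) with hDdef
  set c := ∫ x, mhat x ∂(densityMeasure 𝒳 q) - theta 𝒳 q κ with hc
  have heq : centeredError 𝒳 q p π κ f mhat that =ᵐ[ν] fun u => D u + c := by
    have hπ : ∀ᵐ z ∂ρ, π z.1 ≠ 0 := by
      filter_upwards [hD.ae_π] with z hz using (hD.πmin_pos.trans_le hz.1).ne'
    filter_upwards [ae_unitLaw_of_ae_recordLaw (π := π) hπ] with u hu
    rw [centeredError, inflHat_observe_sub_influence hu]
  have hDmean : ∫ u, D u ∂ν = -c := by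
    refine h2.trans ?_
    have e1 (z : Record d m) : weight m q p z * ((tau f ρ z - that z.1 (pred f z)) +
        ((that z.1 (pred f z) - tau f ρ z) - (mhat z.1 - mu ρ z))) =
        weight m q p z * mu ρ z - weight m q p z * mhat z.1 := by ring
    refine (integral_congr_ae (ae_of_all _ e1)).trans ?_
    rw [integral_sub (integrable_mul_of_ae_abs_le hD.integrable_weight (measurable_mu ρ) hμ)
      (integrable_mul_of_ae_abs_le hD.integrable_weight mM hmC), integral_weight_mul_mu hD hY, hc,
      integral_densityMeasure_eq_integral_weight_mul κ hD.density_q hD.density_p hD.p_pos hm]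
    ring
  have hDint : Integrable D ν := h1.integrable (by norm_num)
  refine ⟨(memLp_congr_ae heq).2 (h1.add (memLp_const c)), ?_, ?_⟩
  · rw [integral_congr_ae heq, integral_add hDint (integrable_const c), hDmean]
    simp
  -- D has mean −c, so adding c removes c² from its second moment; that term can be dropped in an
  -- upper bound.
  have hsq : ∫ u, centeredError 𝒳 q p π κ f mhat that u ^ 2 ∂ν = ∫ u, D u ^ 2 ∂ν - c ^ 2 := by
    have e2 : (fun u => centeredError 𝒳 q p π κ f mhat that u ^ 2) =ᵐ[ν]
        fun u => D u ^ 2 + (2 * c * D u + c ^ 2) := by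
      filter_upwards [heq] with u hu
      rw [hu]
      ring
    have i1 : Integrable (fun u => 2 * c * D u + c ^ 2) ν :=
      (hDint.const_mul _).add (integrable_const _)
    rw [integral_congr_ae e2, integral_add h1.integrable_sq i1,
      integral_add (hDint.const_mul _) (integrable_const _), integral_const_mul, hDmean]
    simp
    ring
  have sq_bd {g : Record d m → ℝ} (hg : ∀ᵐ z ∂ρ, |g z| ≤ C + C) :
      ∀ᵐ z ∂ρ, |g z ^ 2| ≤ (C + C) ^ 2 := by
    filter_upwards [hg] with z hz
    rw [abs_pow]
    exact pow_le_pow_left₀ (abs_nonneg _) hz 2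
  have iT := integrable_mul_of_ae_abs_le (hD.integrable_weight_sq (κ := κ)) (mdT.pow_const 2)
    (sq_bd bdT)
  have iM := integrable_mul_of_ae_abs_le (hD.integrable_weight_sq (κ := κ)) (mdM.pow_const 2)
    (sq_bd bdM)
  -- With a = τ̂ − τ and b = μ̂ − μ: a²/π − 2a(a − b) + (a − b)² = (1/π − 1)a² + b². The products ab
  -- cancel, so the two estimation errors separate.
  have e3 (z : Record d m) : weight m q p z ^ 2 * (1 / π z.1 * (tau f ρ z - that z.1 (pred f z)) ^ 2 +
      2 * ((tau f ρ z - that z.1 (pred f z)) *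
        ((that z.1 (pred f z) - tau f ρ z) - (mhat z.1 - mu ρ z))) +
      ((that z.1 (pred f z) - tau f ρ z) - (mhat z.1 - mu ρ z)) ^ 2) =
      weight m q p z ^ 2 * ((1 / π z.1 - 1) * (that z.1 (pred f z) - tau f ρ z) ^ 2 +
        (mhat z.1 - mu ρ z) ^ 2) := by ring
  simp only [e3] at h3
  rw [hsq, ← integral_const_mul, ← integral_add (iT.const_mul _) iM]
  refine (sub_le_self _ (sq_nonneg c)).trans (h3.trans_le ?_)
  refine integral_mono_of_nonneg ?_ ((iT.const_mul _).add iM) ?_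
  · filter_upwards [hD.ae_π] with z hz
    have hπ1 : 0 ≤ 1 / π z.1 - 1 := by
      rw [sub_nonneg, le_div_iff₀ (hD.πmin_pos.trans_le hz.1), one_mul]
      exact hz.2
    exact mul_nonneg (sq_nonneg _) (add_nonneg (mul_nonneg hπ1 (sq_nonneg _)) (sq_nonneg _))
  · filter_upwards [hD.ae_π] with z hz
    have hπ1 : 1 / π z.1 - 1 ≤ 1 / πmin := by
      linarith [one_div_le_one_div_of_le hD.πmin_pos hz.1]
    rw [mul_left_comm, ← mul_add]
    gcongr

end CenteredError

/-! ### Measurability and independence behind cross-fitting. -/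

section CrossFit

variable {d m K : ℕ} {𝒳 : Set (Vec d)} {q p π : Vec d → ℝ} {κ : Kernel (Vec d) (Vec m × ℝ)}
  {πmin C : ℝ} {f : Vec d × Vec m → ℝ} {𝒰 Ω : Type*} [MeasurableSpace 𝒰]

/-- The observations made by the experimenter. -/
noncomputable def observations (f : Vec d × Vec m → ℝ) (U : ℕ → Ω → Record d m × Bool) (t : ℕ)
    (ω : Ω) : Obs d :=
  observe f (U t ω)

/-- What determines the estimates `μ̂^{-k}` and `τ̂^{-k}` on the event that the fold labels are `s`:
the observations outside fold `k`, the fold labels and the seed. -/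
noncomputable def trainingData (f : Vec d × Vec m → ℝ) (U : ℕ → Ω → Record d m × Bool)
    (S : ℕ → Ω → Fin K) (seed : Ω → 𝒰) (T : ℕ) (k : Fin K) (s : Fin T → Fin K) (ω : Ω) :
    (({t : Fin T // s t ≠ k} → Obs d) × (Fin T → Fin K)) × 𝒰 :=
  ((fun t => observations f U t.1 ω, fun t => S t ω), seed ω)

/-- The centred error of a unit, as a function of the training data. -/
noncomputable def trainedError (𝒳 : Set (Vec d)) (q p π : Vec d → ℝ)
    (κ : Kernel (Vec d) (Vec m × ℝ)) (f : Vec d × Vec m → ℝ) (A : CrossFitLearner d K 𝒰) (T : ℕ)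
    (k : Fin K) (s : Fin T → Fin K)
    (a : (({t : Fin T // s t ≠ k} → Obs d) × (Fin T → Fin K)) × 𝒰) (u : Record d m × Bool) : ℝ :=
  centeredError 𝒳 q p π κ f (A.muHat T k s a.1.1 a.2) (A.tauHat T k s a.1.1 a.2) u

/-- The total centred error of fold `k`. -/
noncomputable def foldError (𝒳 : Set (Vec d)) (q p π : Vec d → ℝ)
    (κ : Kernel (Vec d) (Vec m × ℝ)) (f : Vec d × Vec m → ℝ) (A : CrossFitLearner d K 𝒰)
    (U : ℕ → Ω → Record d m × Bool) (S : ℕ → Ω → Fin K) (seed : Ω → 𝒰) (k : Fin K) (T : ℕ)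
    (ω : Ω) : ℝ :=
  ∑ t ∈ fold S T k ω, centeredError 𝒳 q p π κ f (A.muHatExcl (observations f U) S seed T k ω)
    (A.tauHatExcl (observations f U) S seed T k ω) (U t ω)

/-- Fixing the label assignment replaces the random index set by a deterministic one, for which the
independence of units outside and inside the fold is meaningful. -/
lemma foldError_eq_sum_trainedError (A : CrossFitLearner d K 𝒰)
    (U : ℕ → Ω → Record d m × Bool) (S : ℕ → Ω → Fin K) (seed : Ω → 𝒰) (k : Fin K) (T : ℕ)
    (s : Fin T → Fin K) (ω : Ω) (hs : (fun t : Fin T => S t ω) = s) :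
    foldError 𝒳 q p π κ f A U S seed k T ω = ∑ i : {t : Fin T // s t = k},
      trainedError 𝒳 q p π κ f A T k s (trainingData f U S seed T k s ω) (U i.1 ω) := by
  subst hs
  unfold foldError fold
  rw [Finset.sum_filter, ← Fin.sum_univ_eq_sum_range (fun t => if S t ω = k then
      centeredError 𝒳 q p π κ f (A.muHatExcl (observations f U) S seed T k ω)
        (A.tauHatExcl (observations f U) S seed T k ω) (U t ω) else 0),
    ← Finset.sum_filter]
  exact Finset.sum_subtype _ (fun t => by simp) _

variable [MeasurableSpace Ω] {P : Measure Ω}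

lemma measurable_muHat_record (A : CrossFitLearner d K 𝒰) (T : ℕ) (k : Fin K) (s : Fin T → Fin K) :
    Measurable fun y : ((({t : Fin T // s t ≠ k} → Obs d) × (Fin T → Fin K)) × 𝒰) × Record d m =>
      A.muHat T k s y.1.1.1 y.1.2 y.2.1 :=
  (A.measurable_muHat T k s).comp
    ((measurable_fst.comp (measurable_fst.comp measurable_fst)).prodMk
      ((measurable_snd.comp measurable_fst).prodMk (measurable_fst.comp measurable_snd)))

lemma measurable_tauHat_record (A : CrossFitLearner d K 𝒰) (hf : Measurable f) (T : ℕ) (k : Fin K)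
    (s : Fin T → Fin K) :
    Measurable fun y : ((({t : Fin T // s t ≠ k} → Obs d) × (Fin T → Fin K)) × 𝒰) × Record d m =>
      A.tauHat T k s y.1.1.1 y.1.2 y.2.1 (pred f y.2) :=
  (A.measurable_tauHat T k s).comp
    ((measurable_fst.comp (measurable_fst.comp measurable_fst)).prodMk
      ((measurable_snd.comp measurable_fst).prodMk ((measurable_fst.comp measurable_snd).prodMk
        ((measurable_pred hf).comp measurable_snd))))

lemma measurable_influence (hD : IsRegularDesign 𝒳 q p π πmin) (hf : Measurable f) :
    Measurable (influence 𝒳 q p π κ f) :=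
  measurable_ipwScore hD (measurable_outcome.sub (measurable_tau hf _))
    ((measurable_tau hf _).sub (measurable_mu _))

lemma measurable_trainedError (hD : IsRegularDesign 𝒳 q p π πmin) (hf : Measurable f)
    (A : CrossFitLearner d K 𝒰) (T : ℕ) (k : Fin K) (s : Fin T → Fin K) :
    Measurable (Function.uncurry (trainedError 𝒳 q p π κ f A T k s)) := by
  have := hD.density_q.isProbabilityMeasure
  have hr : Measurable fun y :
      ((({t : Fin T // s t ≠ k} → Obs d) × (Fin T → Fin K)) × 𝒰) × (Record d m × Bool) =>
      (y.1, y.2.1) := measurable_fst.prodMk (measurable_fst.comp measurable_snd)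
  have hM := (measurable_muHat_record (m := m) A T k s).comp hr
  have hT := (measurable_tauHat_record A hf T k s).comp hr
  have hx : Measurable fun y :
      ((({t : Fin T // s t ≠ k} → Obs d) × (Fin T → Fin K)) × 𝒰) × (Record d m × Bool) =>
      y.2.1.1 := measurable_fst.comp (measurable_fst.comp measurable_snd)
  have hδ : Measurable fun y :
      ((({t : Fin T // s t ≠ k} → Obs d) × (Fin T → Fin K)) × 𝒰) × (Record d m × Bool) =>
      ind y.2.2 := measurable_ind.comp (measurable_snd.comp measurable_snd)
  have hY : Measurable fun y :
      ((({t : Fin T // s t ≠ k} → Obs d) × (Fin T → Fin K)) × 𝒰) × (Record d m × Bool) =>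
      outcome y.2.1 := measurable_outcome.comp (measurable_fst.comp measurable_snd)
  have hI : Measurable fun a : (({t : Fin T // s t ≠ k} → Obs d) × (Fin T → Fin K)) × 𝒰 =>
      ∫ x, A.muHat T k s a.1.1 a.2 x ∂(densityMeasure 𝒳 q) := by
    refine (StronglyMeasurable.integral_prod_right (f := fun
      (a : (({t : Fin T // s t ≠ k} → Obs d) × (Fin T → Fin K)) × 𝒰) x =>
        A.muHat T k s a.1.1 a.2 x) (Measurable.stronglyMeasurable ?_)).measurable
    exact (A.measurable_muHat T k s).comp
      ((measurable_fst.comp (measurable_fst.comp measurable_fst)).prodMk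
        ((measurable_snd.comp measurable_fst).prodMk measurable_snd))
  refine Measurable.add (Measurable.sub (Measurable.mul ?_ ?_)
    ((measurable_influence hD hf).comp measurable_snd))
    ((hI.comp measurable_fst).sub measurable_const)
  · exact (hD.density_q.measurable.comp hx).div
      ((hD.measurable_π.comp hx).mul (hD.density_p.measurable.comp hx))
  · exact ((hδ.mul hY).sub (hδ.mul hT)).sub ((hD.measurable_π.comp hx).mul (hM.sub hT))

section Experiment

variable {U : ℕ → Ω → Record d m × Bool} {S : ℕ → Ω → Fin K} {seed : Ω → 𝒰}

lemma measurable_labels (hU : IsExperiment P 𝒳 p π κ U S seed) (T : ℕ) :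
    Measurable fun ω (t : Fin T) => S t ω :=
  measurable_pi_lambda _ fun t => hU.measurable_fold t

lemma measurable_trainingData (hU : IsExperiment P 𝒳 p π κ U S seed) (hf : Measurable f) (T : ℕ)
    (k : Fin K) (s : Fin T → Fin K) : Measurable (trainingData f U S seed T k s) :=
  ((measurable_pi_lambda _ fun _ => (measurable_observe hf).comp (hU.measurable_unit _)).prodMk
    (measurable_labels hU T)).prodMk hU.measurable_seed

/-- The units in fold `k` are independent of the training data of that fold. -/
lemma indepFun_units_trainingData [IsProbabilityMeasure P]
    (hU : IsExperiment P 𝒳 p π κ U S seed) (hf : Measurable f)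
    (T : ℕ) (k : Fin K) (s : Fin T → Fin K) :
    IndepFun (fun ω (i : {t : Fin T // s t = k}) => U i.1 ω) (trainingData f U S seed T k s) P := by
  have hin : Measurable fun ω (i : {t : Fin T // s t = k}) => U i.1 ω :=
    measurable_pi_lambda _ fun i => hU.measurable_unit _
  have hout : Measurable fun ω (i : {t : Fin T // s t ≠ k}) => observations f U i.1 ω :=
    measurable_pi_lambda _ fun i => (measurable_observe hf).comp (hU.measurable_unit _)
  have h1 : IndepFun (fun ω (i : {t : Fin T // s t = k}) => U i.1 ω)
      (fun ω (i : {t : Fin T // s t ≠ k}) => observations f U i.1 ω) P := by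
    have h := (hU.unit_indep.precomp (Fin.val_injective (n := T))).indepFun_finset
      (Finset.univ.filter fun t => s t = k) (Finset.univ.filter fun t => s t ≠ k)
      (Finset.disjoint_filter_filter_not _ _ _) (fun t => hU.measurable_unit t)
    exact h.comp
      (φ := fun v (i : {t : Fin T // s t = k}) => v ⟨i.1, by simp [i.2]⟩)
      (ψ := fun v (i : {t : Fin T // s t ≠ k}) => observe f (v ⟨i.1, by simp [i.2]⟩))
      (measurable_pi_lambda _ fun i => measurable_pi_apply _)
      (measurable_pi_lambda _ fun i => (measurable_observe hf).comp (measurable_pi_apply _))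
  have hpair : Measurable fun v : ℕ → Record d m × Bool =>
      ((fun i : {t : Fin T // s t = k} => v i.1),
        (fun i : {t : Fin T // s t ≠ k} => observe f (v i.1))) :=
    (measurable_pi_lambda _ fun i => measurable_pi_apply _).prodMk
      (measurable_pi_lambda _ fun i => (measurable_observe hf).comp (measurable_pi_apply _))
  have hlab : Measurable fun (v : ℕ → Fin K) (t : Fin T) => v t :=
    measurable_pi_lambda _ fun t => measurable_pi_apply _
  -- The training data are assembled one component at a time: out-of-fold observations, then labels,
  -- then the seed.
  have h2 := indepFun_prodMk_of_indepFun_prodMk hin hout (measurable_labels hU T) h1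
    (hU.unit_indep_fold.comp hpair hlab)
  refine indepFun_prodMk_of_indepFun_prodMk hin (hout.prodMk (measurable_labels hU T))
    hU.measurable_seed h2 ?_
  exact hU.seed_indep.comp
    (φ := fun y : (ℕ → Record d m × Bool) × (ℕ → Fin K) =>
      ((fun i : {t : Fin T // s t = k} => y.1 i.1),
        ((fun i : {t : Fin T // s t ≠ k} => observe f (y.1 i.1)), (fun t : Fin T => y.2 t))))
    ((hpair.fst.comp measurable_fst).prodMk
      ((hpair.snd.comp measurable_fst).prodMk (hlab.comp measurable_snd))) measurable_id

lemma measurable_foldError (hD : IsRegularDesign 𝒳 q p π πmin) (hf : Measurable f)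
    (hU : IsExperiment P 𝒳 p π κ U S seed) (A : CrossFitLearner d K 𝒰) (k : Fin K) (T : ℕ) :
    Measurable (foldError 𝒳 q p π κ f A U S seed k T) := by
  have h : Measurable fun y : (Fin T → Fin K) × Ω => ∑ i : {t : Fin T // y.1 t = k},
      trainedError 𝒳 q p π κ f A T k y.1 (trainingData f U S seed T k y.1 y.2) (U i.1 y.2) := by
    -- There are only finitely many label assignments, so it is enough to check measurability for
    -- each one; this handles the index types that depend on `s`.
    refine measurable_from_prod_countable_right fun s => ?_
    change Measurable fun ω => ∑ i : {t : Fin T // s t = k},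
      trainedError 𝒳 q p π κ f A T k s (trainingData f U S seed T k s ω) (U i.1 ω)
    refine Finset.measurable_fun_sum _ fun i _ => ?_
    exact (measurable_trainedError hD hf A T k s).comp
      ((measurable_trainingData hU hf T k s).prodMk (hU.measurable_unit _))
  convert h.comp ((measurable_labels hU T).prodMk measurable_id) using 1
  funext ω
  exact foldError_eq_sum_trainedError A U S seed k T _ ω rfl

end Experiment

end CrossFit

/-! ### Exact decomposition of the estimator and negligibility of the fold errors. -/

section Remainder

variable {d m K : ℕ} {𝒳 : Set (Vec d)} {q p π : Vec d → ℝ} {κ : Kernel (Vec d) (Vec m × ℝ)}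
  {πmin C : ℝ} {f : Vec d × Vec m → ℝ} {𝒰 Ω : Type*} [MeasurableSpace 𝒰]
  {U : ℕ → Ω → Record d m × Bool} {S : ℕ → Ω → Fin K} {seed : Ω → 𝒰}

/-- Within a fold, N_k cancels the average, and the centring constants carry total weight ∑ N_k = T.
The identity is exact for every outcome, including T = 0 and empty folds, where the division
convention makes all terms zero. -/
lemma sqrt_mul_thetaHat_sub_theta (A : CrossFitLearner d K 𝒰) (T : ℕ) (ω : Ω) :
    √(T : ℝ) * (thetaHat 𝒳 q p π A (observations f U) S seed T ω - theta 𝒳 q κ) =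
      (√(T : ℝ))⁻¹ * ∑ t ∈ Finset.range T, influence 𝒳 q p π κ f (U t ω) +
      ∑ k, (√(T : ℝ))⁻¹ * foldError 𝒳 q p π κ f A U S seed k T ω := by
  rcases T.eq_zero_or_pos with rfl | hT
  · simp
  have hT' : (0 : ℝ) < T := by exact_mod_cast hT
  have hTs : 0 < √(T : ℝ) := Real.sqrt_pos.2 hT'
  have hfiber (g : ℕ → ℝ) : ∑ k, ∑ t ∈ fold S T k ω, g t = ∑ t ∈ Finset.range T, g t :=
    Finset.sum_fiberwise _ _ _
  have hcard : ∑ k, ((fold S T k ω).card : ℝ) = T := by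
    have := hfiber fun _ => 1
    simpa using this
  have hfold (k : Fin K) : foldError 𝒳 q p π κ f A U S seed k T ω =
      T * (((fold S T k ω).card : ℝ) / (T : ℝ) *
        ((∫ x, A.muHatExcl (observations f U) S seed T k ω x ∂(densityMeasure 𝒳 q)) +
          1 / ((fold S T k ω).card : ℝ) * ∑ t ∈ fold S T k ω,
            inflHat q p π (A.muHatExcl (observations f U) S seed T k ω)
              (A.tauHatExcl (observations f U) S seed T k ω) (observations f U t ω))) -
      ∑ t ∈ fold S T k ω, influence 𝒳 q p π κ f (U t ω) -
      ((fold S T k ω).card : ℝ) * theta 𝒳 q κ := by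
    unfold foldError centeredError
    rw [Finset.sum_add_distrib, Finset.sum_sub_distrib, Finset.sum_const, nsmul_eq_mul]
    rcases (fold S T k ω).eq_empty_or_nonempty with he | hne
    · simp [he]
    · have : ((fold S T k ω).card : ℝ) ≠ 0 := by exact_mod_cast hne.card_pos.ne'
      simp only [observations]
      field_simp
      ring
  rw [← Finset.mul_sum, Finset.sum_congr rfl fun k _ => hfold k, Finset.sum_sub_distrib,
    Finset.sum_sub_distrib, hfiber fun t => influence 𝒳 q p π κ f (U t ω), ← Finset.sum_mul,
    hcard, ← Finset.mul_sum, ← thetaHat]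
  have := Real.sq_sqrt hT'.le
  generalize thetaHat 𝒳 q p π A (observations f U) S seed T ω = x
  field_simp
  rw [this]
  ring

variable [MeasurableSpace Ω] {P : Measure Ω}

/-- Makes accuracy of an estimate a measurable condition on the training data, as conditioning on
that data requires. The almost-everywhere bound is expressed as a slice of measure zero. -/
lemma measurableSet_null_and_integral_le {α β : Type*} [MeasurableSpace α] [MeasurableSpace β]
    {ρ : Measure β} [IsFiniteMeasure ρ] {h : α → β → ℝ} (hh : Measurable (Function.uncurry h))
    {g : β → ℝ} (hg : Measurable g) (C δ : ℝ) :
    MeasurableSet {a | (∀ᵐ z ∂ρ, |h a z| ≤ C) ∧ ∫ z, (h a z - g z) ^ 2 ∂ρ ≤ δ} := by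
  have h1 : MeasurableSet {y : α × β | C < |h y.1 y.2|} := measurableSet_lt measurable_const hh.abs
  have h2 : Measurable fun a => ∫ z, (h a z - g z) ^ 2 ∂ρ :=
    (StronglyMeasurable.integral_prod_right (f := fun a z => (h a z - g z) ^ 2)
      ((hh.sub (hg.comp measurable_snd)).pow_const 2).stronglyMeasurable).measurable
  have h3 : MeasurableSet {a | ρ (Prod.mk a ⁻¹' {y : α × β | C < |h y.1 y.2|}) = 0} :=
    measurable_measure_prodMk_left h1 (measurableSet_singleton 0)
  have h4 : {a | ∀ᵐ z ∂ρ, |h a z| ≤ C} =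
      {a | ρ (Prod.mk a ⁻¹' {y : α × β | C < |h y.1 y.2|}) = 0} := by
    ext a
    simp only [Set.mem_ofPred_eq, ae_iff, not_le, Set.preimage_ofPred_eq]
  exact (h4 ▸ h3).inter (measurableSet_le h2 measurable_const)

/-- Where the estimates are accurate, the total error of a fold is `O(√T)` with a small constant. -/
lemma measure_accurate_inter_foldError_le [IsMarkovKernel κ] [IsProbabilityMeasure P]
    (hD : IsRegularDesign 𝒳 q p π πmin) (hf : Measurable f)
    (hU : IsExperiment P 𝒳 p π κ U S seed) (A : CrossFitLearner d K 𝒰)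
    (hY : ∀ᵐ z ∂(recordLaw 𝒳 p κ), |outcome z| ≤ C)
    (hμ : ∀ᵐ z ∂(recordLaw 𝒳 p κ), |mu (recordLaw 𝒳 p κ) z| ≤ C)
    (hτ : ∀ᵐ z ∂(recordLaw 𝒳 p κ), |tau f (recordLaw 𝒳 p κ) z| ≤ C) {η : ℝ} (hη : 0 < η) :
    ∃ δ > 0, ∀ (k : Fin K) (T : ℕ) (ε : ℝ), 0 < T → 0 < ε →
      P {ω | (((∀ᵐ z ∂(recordLaw 𝒳 p κ),
            |A.muHatExcl (observations f U) S seed T k ω z.1| ≤ C) ∧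
          ∫ z, (A.muHatExcl (observations f U) S seed T k ω z.1 -
            mu (recordLaw 𝒳 p κ) z) ^ 2 ∂(recordLaw 𝒳 p κ) ≤ δ) ∧
        ((∀ᵐ z ∂(recordLaw 𝒳 p κ),
            |A.tauHatExcl (observations f U) S seed T k ω z.1 (pred f z)| ≤ C) ∧
          ∫ z, (A.tauHatExcl (observations f U) S seed T k ω z.1 (pred f z) -
            tau f (recordLaw 𝒳 p κ) z) ^ 2 ∂(recordLaw 𝒳 p κ) ≤ δ)) ∧
        ε ≤ |(√(T : ℝ))⁻¹ * foldError 𝒳 q p π κ f A U S seed k T ω|} ≤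
      ENNReal.ofReal (η / ε ^ 2) := by
  have := isProbabilityMeasure_recordLaw (κ := κ) hD.density_p
  have hν : IsProbabilityMeasure (unitLaw 𝒳 p π κ) := by
    rw [← hU.unit_law 0]
    exact Measure.isProbabilityMeasure_map (hU.measurable_unit 0).aemeasurable
  set ρ := recordLaw 𝒳 p κ with hρ
  have hπmin := hD.πmin_pos
  -- With each weighted error at most η/(1/πmin + 1), the bound (1/πmin)·(τ̂ error) + (μ̂ error) is
  -- at most η.
  obtain ⟨δ, hδ, hsmall⟩ := exists_forall_integral_mul_sq_le (hD.integrable_weight_sq (κ := κ))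
    (fun z => sq_nonneg _) (C + C) (ε := η / (1 / πmin + 1)) (by positivity)
  refine ⟨δ, hδ, fun k T ε hT hε => ?_⟩
  have hT' : (0 : ℝ) < T := by exact_mod_cast hT
  have hTs : 0 < √(T : ℝ) := Real.sqrt_pos.2 hT'
  -- Including the labels in the event retains the factor P(S = s) in Chebyshev's bound; summing
  -- over `s` then gives total mass 1 instead of the number of assignments.
  let G (s : Fin T → Fin K) : Set ((({t : Fin T // s t ≠ k} → Obs d) × (Fin T → Fin K)) × 𝒰) :=
    {a | a.1.2 = s ∧
      (((∀ᵐ z ∂ρ, |A.muHat T k s a.1.1 a.2 z.1| ≤ C) ∧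
        ∫ z, (A.muHat T k s a.1.1 a.2 z.1 - mu ρ z) ^ 2 ∂ρ ≤ δ) ∧
      ((∀ᵐ z ∂ρ, |A.tauHat T k s a.1.1 a.2 z.1 (pred f z)| ≤ C) ∧
        ∫ z, (A.tauHat T k s a.1.1 a.2 z.1 (pred f z) - tau f ρ z) ^ 2 ∂ρ ≤ δ))}
  have hG (s : Fin T → Fin K) : MeasurableSet (G s) :=
    ((measurable_snd.comp measurable_fst) (measurableSet_singleton s)).inter
      ((measurableSet_null_and_integral_le (measurable_muHat_record (m := m) A T k s)
        (measurable_mu ρ) C δ).inter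
      (measurableSet_null_and_integral_le (measurable_tauHat_record A hf T k s)
        (measurable_tau hf ρ) C δ))
  have hmom (s : Fin T → Fin K) (a) (ha : a ∈ G s) :
      MemLp (trainedError 𝒳 q p π κ f A T k s a) 2 (unitLaw 𝒳 p π κ) ∧
      ∫ u, trainedError 𝒳 q p π κ f A T k s a u ∂(unitLaw 𝒳 p π κ) = 0 ∧
      ∫ u, trainedError 𝒳 q p π κ f A T k s a u ^ 2 ∂(unitLaw 𝒳 p π κ) ≤ η := by
    obtain ⟨-, ⟨hm1, hm2⟩, ht1, ht2⟩ := ha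
    have hmm : Measurable fun x => A.muHat T k s a.1.1 a.2 x :=
      (A.measurable_muHat T k s).comp (measurable_const.prodMk (measurable_const.prodMk
        measurable_id))
    have htm : Measurable fun y : Vec d × ℝ => A.tauHat T k s a.1.1 a.2 y.1 y.2 :=
      (A.measurable_tauHat T k s).comp (measurable_const.prodMk (measurable_const.prodMk
        measurable_id))
    obtain ⟨h1, h2, h3⟩ := centeredError_moments hD hf hY hμ hτ hmm htm hm1 ht1
    refine ⟨h1, h2, h3.trans ?_⟩
    have h4 := hsmall _ ((hmm.comp measurable_fst).sub (measurable_mu ρ))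
      (ae_abs_sub_le hm1 hμ) hm2
    have h5 := hsmall _ ((htm.comp (measurable_fst.prodMk (measurable_pred hf))).sub
      (measurable_tau hf ρ)) (ae_abs_sub_le ht1 hτ) ht2
    refine (add_le_add (mul_le_mul_of_nonneg_left h5 (by positivity)) h4).trans (le_of_eq ?_)
    field_simp
  have hbound (s : Fin T → Fin K) :
      P {ω | trainingData f U S seed T k s ω ∈ G s ∧ √(T : ℝ) * ε ≤
        |∑ i : {t : Fin T // s t = k},
          trainedError 𝒳 q p π κ f A T k s (trainingData f U S seed T k s ω) (U i.1 ω)|} ≤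
      ENNReal.ofReal (η / ε ^ 2) * P ((fun ω (t : Fin T) => S t ω) ⁻¹' {s}) := by
    refine (measure_inter_le_abs_sum_le (fun i => hU.measurable_unit _)
      (fun i => hU.unit_law _)
      (hU.unit_indep.precomp (Fin.val_injective.comp Subtype.val_injective))
      (measurable_trainingData hU hf T k s) (indepFun_units_trainingData hU hf T k s)
      (measurable_trainedError hD hf A T k s) (hG s) (fun a ha => (hmom s a ha).1)
      (fun a ha => (hmom s a ha).2.1) (fun a ha => (hmom s a ha).2.2) (mul_pos hTs hε)).trans ?_
    refine mul_le_mul' (ENNReal.ofReal_le_ofReal ?_) (measure_mono fun ω hω => hω.1)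
    rw [mul_pow, Real.sq_sqrt hT'.le]
    have hcard : (Fintype.card {t : Fin T // s t = k} : ℝ) ≤ T := by
      exact_mod_cast (Fintype.card_subtype_le _).trans_eq (Fintype.card_fin T)
    -- The fold size, at most T, is offset by the square of the threshold √T·ε, so the bound is free
    -- of T.
    calc _ ≤ (T : ℝ) * η / (T * ε ^ 2) := by gcongr
      _ = η / ε ^ 2 := by field_simp
  calc _ ≤ P (⋃ s ∈ (Finset.univ : Finset (Fin T → Fin K)),
        {ω | trainingData f U S seed T k s ω ∈ G s ∧ √(T : ℝ) * ε ≤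
          |∑ i : {t : Fin T // s t = k},
            trainedError 𝒳 q p π κ f A T k s (trainingData f U S seed T k s ω) (U i.1 ω)|}) := by
        refine measure_mono fun ω hω => ?_
        simp only [Set.mem_iUnion]
        refine ⟨fun t => S t ω, Finset.mem_univ _, ⟨rfl, hω.1⟩, ?_⟩
        rw [← foldError_eq_sum_trainedError A U S seed k T _ ω rfl]
        have h := hω.2
        rwa [abs_mul, abs_inv, abs_of_pos hTs, inv_mul_eq_div, le_div_iff₀ hTs, mul_comm] at h
    _ ≤ ∑ s : Fin T → Fin K,
        ENNReal.ofReal (η / ε ^ 2) * P ((fun ω (t : Fin T) => S t ω) ⁻¹' {s}) :=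
      (measure_biUnion_finset_le _ _).trans (Finset.sum_le_sum fun s _ => hbound s)
    _ = ENNReal.ofReal (η / ε ^ 2) := by
      rw [← Finset.mul_sum, sum_measure_preimage_singleton _
        fun s _ => measurable_labels hU T (measurableSet_singleton s)]
      simp

/-- A large fold error needs an inaccurate μ̂, an inaccurate τ̂, or a large deviation despite
accurate estimates. Each event gets a third of the allowed probability; η, and with it the accuracy
δ, is chosen before T. The almost-sure bounds on the estimates only remove a null set. -/
lemma tendstoInMeasure_foldError [IsMarkovKernel κ] [IsProbabilityMeasure P]
    (hD : IsRegularDesign 𝒳 q p π πmin) (hf : Measurable f)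
    (hU : IsExperiment P 𝒳 p π κ U S seed) (A : CrossFitLearner d K 𝒰)
    (hY : ∀ᵐ z ∂(recordLaw 𝒳 p κ), |outcome z| ≤ C)
    (hμ : ∀ᵐ z ∂(recordLaw 𝒳 p κ), |mu (recordLaw 𝒳 p κ) z| ≤ C)
    (hτ : ∀ᵐ z ∂(recordLaw 𝒳 p κ), |tau f (recordLaw 𝒳 p κ) z| ≤ C) (k : Fin K)
    (hμhat : ∀ T, ∀ᵐ ω ∂P, ∀ᵐ z ∂(recordLaw 𝒳 p κ),
      |A.muHatExcl (observations f U) S seed T k ω z.1| ≤ C)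
    (hτhat : ∀ T, ∀ᵐ ω ∂P, ∀ᵐ z ∂(recordLaw 𝒳 p κ),
      |A.tauHatExcl (observations f U) S seed T k ω z.1 (pred f z)| ≤ C)
    (hμ_cons : TendstoInMeasure P
      (fun (T : ℕ) ω => ∫ z, (A.muHatExcl (observations f U) S seed T k ω z.1 -
        mu (recordLaw 𝒳 p κ) z) ^ 2 ∂(recordLaw 𝒳 p κ)) atTop (fun _ => (0 : ℝ)))
    (hτ_cons : TendstoInMeasure P
      (fun (T : ℕ) ω => ∫ z, (A.tauHatExcl (observations f U) S seed T k ω z.1 (pred f z) -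
        tau f (recordLaw 𝒳 p κ) z) ^ 2 ∂(recordLaw 𝒳 p κ)) atTop (fun _ => (0 : ℝ))) :
    TendstoInMeasure P (fun (T : ℕ) ω => (√(T : ℝ))⁻¹ * foldError 𝒳 q p π κ f A U S seed k T ω)
      atTop (fun _ => (0 : ℝ)) := by
  rw [tendstoInMeasure_iff_norm] at hμ_cons hτ_cons ⊢
  intro ε hε
  rw [ENNReal.tendsto_nhds_zero]
  intro b hb
  obtain ⟨η, hη, hηb⟩ : ∃ η : ℝ, 0 < η ∧ ENNReal.ofReal (η / ε ^ 2) ≤ b / 3 := by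
    obtain ⟨r, hr0, hrb⟩ := ENNReal.lt_iff_exists_nnreal_btwn.1
      (show (0 : ℝ≥0∞) < b / 3 from ENNReal.div_pos hb.ne' (by norm_num))
    refine ⟨r * ε ^ 2, mul_pos (by exact_mod_cast hr0) (by positivity), ?_⟩
    rw [mul_div_cancel_right₀ _ (by positivity), ENNReal.ofReal_coe_nnreal]
    exact hrb.le
  obtain ⟨δ, hδ, hacc⟩ := measure_accurate_inter_foldError_le hD hf hU A hY hμ hτ hη
  have hb3 : 0 < b / 3 := ENNReal.div_pos hb.ne' (by norm_num)
  filter_upwards [ENNReal.tendsto_nhds_zero.1 (hμ_cons δ hδ) _ hb3,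
    ENNReal.tendsto_nhds_zero.1 (hτ_cons δ hδ) _ hb3, eventually_gt_atTop 0] with T h1 h2 hT
  refine (measure_mono_ae ?_).trans ((measure_union_le _ _).trans ((add_le_add
    ((measure_union_le _ _).trans (add_le_add h1 h2))
    ((hacc k T ε hT hε).trans hηb)).trans_eq (ENNReal.add_thirds b)))
  filter_upwards [hμhat T, hτhat T] with ω hm ht hω
  change ε ≤ ‖_ - (0 : ℝ)‖ at hω
  rw [sub_zero, Real.norm_eq_abs] at hω
  change ω ∈ (_ ∪ _ ∪ _ : Set Ω)
  by_contra hc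
  simp only [Set.mem_union, Set.mem_ofPred_eq, sub_zero, Real.norm_eq_abs, not_or, not_le] at hc
  obtain ⟨⟨c1, c2⟩, c3⟩ := hc
  exact c3 ⟨⟨⟨hm, (le_abs_self _).trans c1.le⟩, ⟨ht, (le_abs_self _).trans c2.le⟩⟩, hω⟩

end Remainder

end PGAE

/-! ### Central limit theorem and Slutsky. -/

theorem mainTheorem3 {d m K : ℕ} {𝒰 Ω : Type*} [MeasurableSpace 𝒰] [MeasurableSpace Ω]
    (P : Measure Ω) [IsProbabilityMeasure P]
    -- the population and the predictor
    (𝒳 : Set (PGAE.Vec d)) (h𝒳 : MeasurableSet 𝒳)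
    (q : PGAE.Vec d → ℝ) (hq : PGAE.IsDensityOn 𝒳 q)
    (κ : Kernel (PGAE.Vec d) (PGAE.Vec m × ℝ)) [IsMarkovKernel κ]
    (f : PGAE.Vec d × PGAE.Vec m → ℝ) (hf : Measurable f)
    -- the design
    (p : PGAE.Vec d → ℝ) (hp : PGAE.IsDensityOn 𝒳 p)
    (π : PGAE.Vec d → ℝ) (hπ : Measurable π)
    (hπ_le : ∀ᵐ x ∂(volume.restrict 𝒳), π x ≤ 1)
    -- the experiment, the observations `Z`, and the learning procedures
    (U : ℕ → Ω → PGAE.Record d m × Bool) (S : ℕ → Ω → Fin K) (seed : Ω → 𝒰)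
    (hU : PGAE.IsExperiment P 𝒳 p π κ U S seed)
    (Z : ℕ → Ω → PGAE.Obs d) (hZ : ∀ t ω, Z t ω = PGAE.observe f (U t ω))
    (A : PGAE.CrossFitLearner d K 𝒰)
    -- `p` and `π` are bounded below
    (pmin πmin C : ℝ) (hpmin : 0 < pmin) (hπmin : 0 < πmin)
    (hp_ge : ∀ᵐ x ∂(volume.restrict 𝒳), pmin ≤ p x)
    (hπ_ge : ∀ᵐ x ∂(volume.restrict 𝒳), πmin ≤ π x)
    -- the importance weight `q / p` has a finite second moment
    (hqp : Integrable (fun x => (q x / p x) ^ 2) (PGAE.densityMeasure 𝒳 p))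
    -- `|Y|`, `|μ|`, `|τ|`, `|μ̂|`, `|τ̂|` are at most `C`
    (hY : ∀ᵐ z ∂(PGAE.recordLaw 𝒳 p κ), |PGAE.outcome z| ≤ C)
    (hμ : ∀ᵐ z ∂(PGAE.recordLaw 𝒳 p κ), |PGAE.mu (PGAE.recordLaw 𝒳 p κ) z| ≤ C)
    (hτ : ∀ᵐ z ∂(PGAE.recordLaw 𝒳 p κ), |PGAE.tau f (PGAE.recordLaw 𝒳 p κ) z| ≤ C)
    (hμhat : ∀ T k, ∀ᵐ ω ∂P, ∀ᵐ z ∂(PGAE.recordLaw 𝒳 p κ),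
      |A.muHatExcl Z S seed T k ω z.1| ≤ C)
    (hτhat : ∀ T k, ∀ᵐ ω ∂P, ∀ᵐ z ∂(PGAE.recordLaw 𝒳 p κ),
      |A.tauHatExcl Z S seed T k ω z.1 (PGAE.pred f z)| ≤ C)
    -- `μ̂^{-k}` and `τ̂^{-k}` are consistent in mean square
    (hμ_cons : ∀ k, TendstoInMeasure P
      (fun (T : ℕ) ω => ∫ z, (A.muHatExcl Z S seed T k ω z.1 -
        PGAE.mu (PGAE.recordLaw 𝒳 p κ) z) ^ 2 ∂(PGAE.recordLaw 𝒳 p κ)) atTop (fun _ => (0 : ℝ)))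
    (hτ_cons : ∀ k, TendstoInMeasure P
      (fun (T : ℕ) ω => ∫ z, (A.tauHatExcl Z S seed T k ω z.1 (PGAE.pred f z) -
        PGAE.tau f (PGAE.recordLaw 𝒳 p κ) z) ^ 2 ∂(PGAE.recordLaw 𝒳 p κ)) atTop
      (fun _ => (0 : ℝ))) :
    Integrable (PGAE.boundIntegrand 𝒳 q p π κ f) (PGAE.recordLaw 𝒳 p κ) ∧
    0 ≤ PGAE.effBound 𝒳 q p π κ f ∧
    TendstoInDistribution
      (fun (T : ℕ) (ω : Ω) => √(T : ℝ) *
        (PGAE.thetaHat 𝒳 q p π A Z S seed T ω - PGAE.theta 𝒳 q κ))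
      atTop (id : ℝ → ℝ) (fun _ => P)
      (gaussianReal 0 (PGAE.effBound 𝒳 q p π κ f).toNNReal) := by
  have hD : PGAE.IsRegularDesign 𝒳 q p π πmin :=
    ⟨hq, hp, hπ, hp_ge.mono fun x hx => hpmin.trans_le hx, hπmin, hπ_ge, hπ_le, hqp⟩
  obtain rfl : Z = PGAE.observations f U := by
    funext t ω
    exact hZ t ω
  obtain ⟨h1, h2, h3, h4⟩ := PGAE.influence_moments hD hf hY hμ hτ
  refine ⟨h3, h4 ▸ integral_nonneg fun u => sq_nonneg _, ?_⟩
  have hm := PGAE.measurable_influence (κ := κ) hD hf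
  have hmap (g : PGAE.Record d m × Bool → ℝ) (hg : Measurable g) :
      ∫ ω, g (U 0 ω) ∂P = ∫ u, g u ∂(PGAE.unitLaw 𝒳 p π κ) := by
    rw [← hU.unit_law 0, integral_map (hU.measurable_unit 0).aemeasurable hg.aestronglyMeasurable]
  have hmean : ∫ ω, PGAE.influence 𝒳 q p π κ f (U 0 ω) ∂P = 0 := (hmap _ hm).trans h2
  have hvar : variance (fun ω => PGAE.influence 𝒳 q p π κ f (U 0 ω)) P =
      PGAE.effBound 𝒳 q p π κ f := by
    have hX : Measurable fun ω => PGAE.influence 𝒳 q p π κ f (U 0 ω) :=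
      hm.comp (hU.measurable_unit 0)
    rw [variance_of_integral_eq_zero hX.aemeasurable hmean, ← h4]
    exact hmap _ (hm.pow_const 2)
  have hL2 : MemLp (fun ω => PGAE.influence 𝒳 q p π κ f (U 0 ω)) 2 P := by
    rw [← hU.unit_law 0] at h1
    exact h1.comp_of_map (hU.measurable_unit 0).aemeasurable
  -- The limit variable is the identity under the Gaussian law. Since V ≥ 0, `toNNReal` loses
  -- nothing, and V = 0 gives the point mass at 0.
  have hclt := tendstoInDistribution_inv_sqrt_mul_sum_sub (P := P)
    (P' := gaussianReal 0 (PGAE.effBound 𝒳 q p π κ f).toNNReal) (Y := (id : ℝ → ℝ))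
    (X := fun t ω => PGAE.influence 𝒳 q p π κ f (U t ω))
    ⟨aemeasurable_id, by rw [Measure.map_id, hvar]⟩ hL2
    (hU.unit_indep.comp _ fun _ => hm)
    (fun t => IdentDistrib.comp ⟨(hU.measurable_unit t).aemeasurable,
      (hU.measurable_unit 0).aemeasurable, by rw [hU.unit_law, hU.unit_law]⟩ hm)
  have hrem := PGAE.tendstoInMeasure_finset_sum_zero (P := P) Finset.univ
    (R := fun k (T : ℕ) ω => (√(T : ℝ))⁻¹ * PGAE.foldError 𝒳 q p π κ f A U S seed k T ω)
    (fun k _ => PGAE.tendstoInMeasure_foldError hD hf hU A hY hμ hτ k (fun T => hμhat T k)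
      (fun T => hτhat T k) (hμ_cons k) (hτ_cons k))
  -- Slutsky: the remainder tends to 0 in probability, so the sum has the Gaussian limit.
  have hsum := hclt.add_of_tendstoInMeasure_const hrem fun T =>
    (Finset.measurable_fun_sum _ fun k _ =>
      (PGAE.measurable_foldError hD hf hU A k T).const_mul _).aemeasurable
  refine hsum.congr (fun T => ae_of_all _ fun ω => ?_) (ae_of_all _ fun x => add_zero x)
  rw [Pi.add_apply, hmean, mul_zero, sub_zero]
  exact (PGAE.sqrt_mul_thetaHat_sub_theta A T ω).symm
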